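/- Let $k$ be an algebraically closed field of characteristic $0$, let $X$ be a projective variety (integral projective scheme) over $k$, and let a finite group $G$ act on $X$ by $k$-automorphisms. Let $\pi : X \to X/G$ be the quotient, i.e. the quotient as a ringed space: the points of $X/G$ are the $G$-orbits with the quotient topology, and $\mathcal{O}_{X/G} = (\pi_*\mathcal{O}_X)^G$. Let $D = \frac1n E$ be a $\mathbb{Q}$-Cartier divisor on $X/G$, where $n \ge 1$ and $E$ is a Cartier divisor, and let $\pi^*D = \frac1n \pi^*E$. Assume that $X$ is normal or that $D$ is Cartier ($n = 1$), so that the sheaves $\mathcal{O}(mD)$ and $\mathcal{O}(m\pi^*D)$ are defined for all $m \ge 0$. For $(Z, B) = (X, \pi^*D)$ or $(X/G, D)$ put \[ R(Z, B) = \bigoplus_{m \ge 0} H^0(Z, \mathcal{O}_Z(mB)), \] where $\mathcal{O}_Z(mB)$ is the usual invertible sheaf if $B$ is Cartier and $\mathcal{O}_Z(mB) = \mathcal{O}_Z(\lfloor mB \rfloor)$ if $Z$ is normal; in terms of rational functions, $H^0(Z, \mathcal{O}_Z(mB))$ consists of all $f \in k(Z)$ such that $f^n e^m \in \mathcal{O}_{Z,z}$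 for every $z \in Z$ and every local equation $e$ of $nB$ at $z$. The group $G$ acts on $R(X, \pi^*D)$ by pull-back of sections, hence on $Y := \mathrm{Proj}\, R(X, \pi^*D)$. If $R(X, \pi^*D)$ is a finitely generated $k$-algebra, then $R(X/G, D)$ is a finitely generated $k$-algebra and $\mathrm{Proj}\, R(X/G, D) = Y/G$, i.e. there is a $k$-morphism $Y \to \mathrm{Proj}\, R(X/G, D)$ which is the quotient of $Y$ by $G$ (as a ringed space, as above). -/

import Mathlib

open CategoryTheory AlgebraicGeometry

universe u v

noncomputable section

namespace FiniteQuotient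

/-! ### Function fields -/

/-- A scheme is normal if all its local rings are integrally closed domains
(used for integral schemes only, so that the local rings are domains). -/
def IsNormal (X : Scheme.{u}) : Prop :=
  ∀ x : X, IsIntegrallyClosed (X.presheaf.stalk x)

theorem map_genericPoint {X Y : Scheme.{u}} [IsIntegral X] [IsIntegral Y] (φ : X ⟶ Y)
    (hφ : IsDominant φ) : φ (genericPoint X) = genericPoint Y := by
  have h1 : IsGenericPoint (φ (genericPoint X)) (closure (φ '' Set.univ)) :=
    (genericPoint_spec X).image φ.continuous
  rw [Set.image_univ, φ.denseRange.closure_range] at h1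
  exact h1.eq (genericPoint_spec Y)

/-- The pull-back `K(Y) → K(X)` of rational functions along a dominant morphism `X ⟶ Y` of
integral schemes. -/
def functionFieldMap {X Y : Scheme.{u}} [IsIntegral X] [IsIntegral Y] (φ : X ⟶ Y)
    (hφ : IsDominant φ) : Y.functionField →+* X.functionField :=
  (Y.presheaf.stalkSpecializes (specializes_of_eq (map_genericPoint φ hφ)) ≫
    φ.stalkMap (genericPoint X)).hom

/-- The pull-back of rational functions is compatible with the maps of local rings. -/
theorem functionFieldMap_algebraMap {X Y : Scheme.{u}} [IsIntegral X] [IsIntegral Y] (φ : X ⟶ Y)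
    (hφ : IsDominant φ) (x : X) (a : Y.presheaf.stalk (φ x)) :
    functionFieldMap φ hφ (algebraMap (Y.presheaf.stalk (φ x)) Y.functionField a) =
      algebraMap (X.presheaf.stalk x) X.functionField (φ.stalkMap x a) := by
  have := φ.stalkSpecializes_stalkMap (genericPoint X) x (genericPoint_specializes x)
  have h2 := congr($(this).hom a)
  simp only [functionFieldMap, RingHom.algebraMap_toAlgebra]
  rw [← CommRingCat.comp_apply, TopCat.Presheaf.stalkSpecializes_comp_assoc]
  exact h2

theorem functionFieldMap_comp {X Y Z : Scheme.{u}} [IsIntegral X] [IsIntegral Y] [IsIntegral Z]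
    (φ : X ⟶ Y) (ψ : Y ⟶ Z) (hφ : IsDominant φ) (hψ : IsDominant ψ) (h : IsDominant (φ ≫ ψ))
    (f : Z.functionField) :
    functionFieldMap (φ ≫ ψ) h f = functionFieldMap φ hφ (functionFieldMap ψ hψ f) := by
  have key : ∀ a : Z.presheaf.stalk ((φ ≫ ψ) (genericPoint X)),
      functionFieldMap (φ ≫ ψ) h (algebraMap _ Z.functionField a) =
        functionFieldMap φ hφ (functionFieldMap ψ hψ (algebraMap _ Z.functionField a)) := by
    intro a
    rw [functionFieldMap_algebraMap]
    erw [functionFieldMap_algebraMap ψ hψ (φ (genericPoint X)) a]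
    rw [functionFieldMap_algebraMap]
    rw [Scheme.Hom.stalkMap_comp]
    rfl
  obtain ⟨a, b, -, rfl⟩ := IsFractionRing.div_surjective
    (A := Z.presheaf.stalk ((φ ≫ ψ) (genericPoint X))) f
  simp only [map_div₀, key]

theorem functionFieldMap_id {X : Scheme.{u}} [IsIntegral X] (h : IsDominant (𝟙 X))
    (f : X.functionField) : functionFieldMap (𝟙 X) h f = f := by
  have key : ∀ (x : X) (a : X.presheaf.stalk x),
      functionFieldMap (𝟙 X) h (algebraMap _ X.functionField a) =
        algebraMap _ X.functionField a := by
    intro x a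
    refine (functionFieldMap_algebraMap (𝟙 X) h x a).trans ?_
    rw [Scheme.Hom.stalkMap_id]
    rfl
  obtain ⟨x⟩ : Nonempty X := inferInstance
  obtain ⟨a, b, -, rfl⟩ := IsFractionRing.div_surjective (A := X.presheaf.stalk x) f
  simp only [map_div₀, key]

/-! ### Cartier divisors and ℚ-Cartier divisors -/

/-- The local ring `𝒪_{X,x}` as a subring of the function field `K(X)`. -/
def localRing (X : Scheme.{u}) [IsIntegral X] (x : X) : Subring X.functionField :=
  (algebraMap (X.presheaf.stalk x) X.functionField).range

/-- The subgroup `𝒪_{X,x}ˣ` of `K(X)ˣ`. -/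
def localUnits (X : Scheme.{u}) [IsIntegral X] (x : X) : Subgroup X.functionFieldˣ :=
  (Units.map (algebraMap (X.presheaf.stalk x) X.functionField).toMonoidHom).range

theorem functionFieldMap_mem_localRing {X Y : Scheme.{u}} [IsIntegral X] [IsIntegral Y]
    (φ : X ⟶ Y) (hφ : IsDominant φ) (x : X) {f : Y.functionField}
    (hf : f ∈ localRing Y (φ x)) : functionFieldMap φ hφ f ∈ localRing X x := by
  obtain ⟨a, rfl⟩ := hf
  exact ⟨φ.stalkMap x a, (functionFieldMap_algebraMap φ hφ x a).symm⟩

theorem localUnits_le_comap {X Y : Scheme.{u}} [IsIntegral X] [IsIntegral Y]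
    (φ : X ⟶ Y) (hφ : IsDominant φ) (x : X) :
    localUnits Y (φ x) ≤
      (localUnits X x).comap (Units.map (functionFieldMap φ hφ).toMonoidHom) := by
  rintro _ ⟨a, rfl⟩
  refine ⟨Units.map (φ.stalkMap x).hom.toMonoidHom a, ?_⟩
  ext
  exact (functionFieldMap_algebraMap φ hφ x a).symm

theorem mem_localRing_of_mem_localUnits {X : Scheme.{u}} [IsIntegral X] {x : X}
    {e : X.functionFieldˣ} (he : e ∈ localUnits X x) :
    (e : X.functionField) ∈ localRing X x := by
  obtain ⟨a, rfl⟩ := he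
  exact ⟨a, rfl⟩

/-- A Cartier divisor on an integral scheme `X`: a global section of the sheaf `𝒦ˣ / 𝒪ˣ`, where
`𝒦` is the constant sheaf `K(X)`; that is, a family of germs in the stalks `K(X)ˣ / 𝒪_{X,x}ˣ`
which is locally given by one rational function (a local equation). -/
structure CartierDivisor (X : Scheme.{u}) [IsIntegral X] where
  germ : ∀ x : X, X.functionFieldˣ ⧸ localUnits X x
  exists_local_equation : ∀ x : X, ∃ U : X.Opens, x ∈ U ∧
    ∃ e : X.functionFieldˣ, ∀ y ∈ U, germ y = (e : X.functionFieldˣ ⧸ localUnits X y)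

/-- The pull-back of a Cartier divisor along a dominant morphism: local equations are pulled
back. -/
def CartierDivisor.pullback {X Y : Scheme.{u}} [IsIntegral X] [IsIntegral Y]
    (E : CartierDivisor Y) (φ : X ⟶ Y) (hφ : IsDominant φ) : CartierDivisor X where
  germ x := QuotientGroup.map (localUnits Y (φ x)) (localUnits X x)
    (Units.map (functionFieldMap φ hφ).toMonoidHom) (localUnits_le_comap φ hφ x) (E.germ (φ x))
  exists_local_equation x := by
    obtain ⟨U, hU, e, he⟩ := E.exists_local_equation (φ x)
    refine ⟨φ ⁻¹ᵁ U, hU, Units.map (functionFieldMap φ hφ).toMonoidHom e, fun y hy => ?_⟩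
    rw [he (φ y) hy]
    rfl

/-- A ℚ-Cartier divisor `D = (1/index) • numerator` on an integral scheme `X`.
The scheme `X` has to be normal unless `D` is Cartier (`index = 1`); on a non-normal scheme there
is no sheaf `𝒪(mD)` for a fractional `mD`. On a normal scheme, Cartier divisors embed into Weil
divisors, and these are exactly the ℚ-Weil divisors with a Cartier multiple. -/
structure QCartierDivisor (X : Scheme.{u}) [IsIntegral X] where
  index : ℕ
  index_pos : 0 < index
  numerator : CartierDivisor X
  normal_or_cartier : IsNormal X ∨ index = 1

/-- The pull-back `(1/n) • φ^*E` of a ℚ-Cartier divisor `(1/n) • E`. -/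
def QCartierDivisor.pullback {X Y : Scheme.{u}} [IsIntegral X] [IsIntegral Y]
    (D : QCartierDivisor Y) (φ : X ⟶ Y) (hφ : IsDominant φ) (h : IsNormal X ∨ D.index = 1) :
    QCartierDivisor X where
  index := D.index
  index_pos := D.index_pos
  numerator := D.numerator.pullback φ hφ
  normal_or_cartier := h

/-! ### Section rings -/

/-- The group `H⁰(X, 𝒪_X(mD)) ⊆ K(X)` of rational functions `f` with `f = 0` or
`div f + mD ≥ 0`. If `D = (1/n) E` and `e` is a local equation of `E` at `x`, the condition at `x`
is that `f ^ n * e ^ m` is regular at `x`. For `n = 1` this is the group of sections of the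
invertible sheaf `𝒪_X(mE)`; on a normal scheme it is the group of sections of `𝒪_X(⌊mD⌋)`. -/
def QCartierDivisor.sections {X : Scheme.{u}} [IsIntegral X] (D : QCartierDivisor X) (m : ℕ) :
    AddSubgroup X.functionField where
  carrier := {f | ∀ (x : X) (e : X.functionFieldˣ),
    (e : X.functionFieldˣ ⧸ localUnits X x) = D.numerator.germ x →
      f ^ D.index * (e : X.functionField) ^ m ∈ localRing X x}
  zero_mem' x e _ := by
    rw [zero_pow D.index_pos.ne', zero_mul]
    exact zero_mem _
  neg_mem' {f} hf x e he := by
    rw [neg_pow, mul_assoc]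
    exact mul_mem (pow_mem (neg_mem (one_mem _)) _) (hf x e he)
  add_mem' {f g} hf hg x e he := by
    have h1 := hf x e he
    have h2 := hg x e he
    rcases D.normal_or_cartier with hn | hn
    · have := hn x
      rw [add_pow, Finset.sum_mul]
      refine sum_mem fun i hi => ?_
      have hij : i + (D.index - i) = D.index :=
        Nat.add_sub_cancel' (Nat.lt_succ_iff.mp (Finset.mem_range.mp hi))
      generalize D.index - i = j at hij ⊢
      have hpos := D.index_pos
      rw [← hij] at h1 h2 hpos ⊢
      obtain ⟨a, ha⟩ : (f ^ i * g ^ j * (e : X.functionField) ^ m) ^ (i + j) ∈ localRing X x := by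
        have : (f ^ i * g ^ j * (e : X.functionField) ^ m) ^ (i + j) =
            (f ^ (i + j) * (e : X.functionField) ^ m) ^ i *
              (g ^ (i + j) * (e : X.functionField) ^ m) ^ j := by
          ring
        rw [this]
        exact mul_mem (pow_mem h1 _) (pow_mem h2 _)
      obtain ⟨b, hb⟩ := IsIntegrallyClosed.exists_algebraMap_eq_of_isIntegral_pow
        (R := X.presheaf.stalk x) hpos (ha ▸ isIntegral_algebraMap)
      rw [mul_right_comm]
      exact mul_mem ⟨b, hb⟩ (natCast_mem _ _)
    · rw [hn, pow_one] at h1 h2 ⊢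
      rw [add_mul]
      exact add_mem h1 h2

theorem QCartierDivisor.one_mem_sections {X : Scheme.{u}} [IsIntegral X] (D : QCartierDivisor X) :
    (1 : X.functionField) ∈ D.sections 0 := fun x e _ => by
  rw [one_pow, pow_zero, one_mul]
  exact one_mem _

theorem QCartierDivisor.mul_mem_sections {X : Scheme.{u}} [IsIntegral X] (D : QCartierDivisor X)
    {m l : ℕ} {f g : X.functionField} (hf : f ∈ D.sections m) (hg : g ∈ D.sections l) :
    f * g ∈ D.sections (m + l) := fun x e he => by
  have : (f * g) ^ D.index * (e : X.functionField) ^ (m + l) =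
      (f ^ D.index * (e : X.functionField) ^ m) * (g ^ D.index * (e : X.functionField) ^ l) := by
    ring
  rw [this]
  exact mul_mem (hf x e he) (hg x e he)

/-- The section ring `R(X, D) = ⨁ₘ H⁰(X, 𝒪_X(mD))`, as the subring of all polynomials
`∑ₘ fₘ tᵐ` in `K(X)[t]` with `fₘ ∈ H⁰(X, 𝒪_X(mD))`. -/
def QCartierDivisor.sectionRing {X : Scheme.{u}} [IsIntegral X] (D : QCartierDivisor X) :
    Subring (Polynomial X.functionField) where
  carrier := {p | ∀ m, p.coeff m ∈ D.sections m}
  zero_mem' m := by simp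
  one_mem' m := by
    rw [Polynomial.coeff_one]
    split_ifs with h
    · rw [h]; exact D.one_mem_sections
    · exact zero_mem _
  neg_mem' hp m := by rw [Polynomial.coeff_neg]; exact neg_mem (hp m)
  add_mem' hp hq m := by rw [Polynomial.coeff_add]; exact add_mem (hp m) (hq m)
  mul_mem' hp hq m := by
    rw [Polynomial.coeff_mul]
    refine sum_mem fun ij hij => ?_
    rw [← Finset.HasAntidiagonal.mem_antidiagonal.mp hij]
    exact D.mul_mem_sections (hp _) (hq _)

/-- The degree `m` part `H⁰(X, 𝒪_X(mD)) tᵐ` of the section ring. -/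
def QCartierDivisor.grading {X : Scheme.{u}} [IsIntegral X] (D : QCartierDivisor X) (m : ℕ) :
    AddSubgroup D.sectionRing where
  carrier := {p | ∀ i, i ≠ m → (p : Polynomial X.functionField).coeff i = 0}
  zero_mem' i _ := by simp
  neg_mem' hp i hi := by simp [hp i hi]
  add_mem' hp hq i hi := by simp [hp i hi, hq i hi]

/-- The homogeneous component of degree `m` of an element of the section ring. -/
def QCartierDivisor.component {X : Scheme.{u}} [IsIntegral X] (D : QCartierDivisor X)
    (p : D.sectionRing) (m : ℕ) : D.grading m :=
  ⟨⟨Polynomial.monomial m ((p : Polynomial X.functionField).coeff m), fun i => by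
      rw [Polynomial.coeff_monomial]
      split_ifs with h
      · rw [← h]; exact p.2 m
      · exact zero_mem _⟩,
    fun i hi => Polynomial.coeff_monomial_of_ne _ hi⟩

theorem QCartierDivisor.coeff_coeAddMonoidHom {X : Scheme.{u}} [IsIntegral X]
    (D : QCartierDivisor X) (y : DirectSum ℕ fun m => D.grading m) (i : ℕ) :
    ((DirectSum.coeAddMonoidHom D.grading y : D.sectionRing) :
      Polynomial X.functionField).coeff i =
      ((y i : D.sectionRing) : Polynomial X.functionField).coeff i := by
  induction y using DirectSum.induction_on with
  | zero => simp
  | of j a =>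
    rw [DirectSum.coeAddMonoidHom_of]
    by_cases h : i = j
    · subst h; rw [DirectSum.of_eq_same]
    · rw [DirectSum.of_eq_of_ne _ _ _ h, a.2 i h]; simp
  | add a b ha hb => simp [ha, hb]

instance QCartierDivisor.gradedRing {X : Scheme.{u}} [IsIntegral X] (D : QCartierDivisor X) :
    GradedRing D.grading where
  one_mem i hi := by
    change (1 : Polynomial X.functionField).coeff i = 0
    rw [Polynomial.coeff_one, if_neg hi]
  mul_mem m l p q hp hq i hi := by
    change ((p : Polynomial X.functionField) * q).coeff i = 0
    rw [Polynomial.coeff_mul]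
    refine Finset.sum_eq_zero fun ab hab => ?_
    by_cases h1 : ab.1 = m
    · by_cases h2 : ab.2 = l
      · exact absurd (by rw [← Finset.HasAntidiagonal.mem_antidiagonal.mp hab, h1, h2]) hi
      · rw [hq _ h2, mul_zero]
    · rw [hp _ h1, zero_mul]
  decompose' p := DirectSum.mk (fun m => D.grading m)
    (p : Polynomial X.functionField).support fun m => D.component p m
  left_inv p := by
    apply Subtype.ext
    ext i
    rw [D.coeff_coeAddMonoidHom]
    by_cases h : i ∈ (p : Polynomial X.functionField).support
    · rw [DirectSum.mk_apply_of_mem h]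
      simp [component]
    · rw [DirectSum.mk_apply_of_notMem h]
      simp [Polynomial.notMem_support_iff.mp h]
  right_inv y := by
    refine DFinsupp.ext fun i => Subtype.ext (Subtype.ext (Polynomial.ext fun j => ?_))
    by_cases hj : j = i
    · subst hj
      rw [← D.coeff_coeAddMonoidHom y]
      set p := DirectSum.coeAddMonoidHom D.grading y
      by_cases h : j ∈ (p : Polynomial X.functionField).support
      · erw [DirectSum.mk_apply_of_mem h]
        simp [component]
      · erw [DirectSum.mk_apply_of_notMem h]
        simp [Polynomial.notMem_support_iff.mp h]
    · exact ((DirectSum.mk (fun m => D.grading m) _ _ i).2 j hj).trans ((y i).2 j hj).symm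


/-! ### Base field, Proj -/

/-- The constants `k → K(X)` of an integral scheme over a field `k`. -/
def constants {k : Type u} [Field k] {X : Scheme.{u}} [IsIntegral X]
    (s : X ⟶ Spec (.of k)) : k →+* X.functionField :=
  (X.presheaf.germ ⊤ (genericPoint X) trivial).hom.comp
    (s.appTop.hom.comp (Scheme.ΓSpecIso (.of k)).inv.hom)

theorem constants_mem_localRing {k : Type u} [Field k] {X : Scheme.{u}} [IsIntegral X]
    (s : X ⟶ Spec (.of k)) (c : k) (x : X) : constants s c ∈ localRing X x :=
  ⟨X.presheaf.germ ⊤ x trivial (s.appTop.hom ((Scheme.ΓSpecIso (.of k)).inv.hom c)), by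
    have : Nonempty (⊤ : X.Opens) := ⟨⟨x, trivial⟩⟩
    exact Scheme.algebraMap_germ_eq_germToFunctionField X (U := ⊤) (x := x) trivial _⟩

theorem QCartierDivisor.constants_mem_sections {k : Type u} [Field k] {X : Scheme.{u}}
    [IsIntegral X] (D : QCartierDivisor X) (s : X ⟶ Spec (.of k)) (c : k) :
    constants s c ∈ D.sections 0 := fun x e _ => by
  rw [pow_zero, mul_one]
  exact pow_mem (constants_mem_localRing s c x) _

/-- The section ring of a `k`-scheme as a `k`-algebra. -/
def QCartierDivisor.baseHom {k : Type u} [Field k] {X : Scheme.{u}}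
    [IsIntegral X] (D : QCartierDivisor X) (s : X ⟶ Spec (.of k)) : k →+* D.sectionRing :=
  (Polynomial.C.comp (constants s)).codRestrict D.sectionRing fun c m => by
    change (Polynomial.C (constants s c)).coeff m ∈ _
    rw [Polynomial.coeff_C]
    split_ifs with h
    · rw [h]; exact D.constants_mem_sections s c
    · exact zero_mem _

/-- The same homomorphism with values in the degree `0` part. -/
def QCartierDivisor.baseHomZero {k : Type u} [Field k] {X : Scheme.{u}}
    [IsIntegral X] (D : QCartierDivisor X) (s : X ⟶ Spec (.of k)) : k →+* D.grading 0 where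
  toFun c := ⟨D.baseHom s c, fun _ hi => Polynomial.coeff_C_of_ne_zero hi⟩
  map_one' := Subtype.ext (map_one (D.baseHom s))
  map_zero' := Subtype.ext (map_zero (D.baseHom s))
  map_mul' a b := Subtype.ext (map_mul (D.baseHom s) a b)
  map_add' a b := Subtype.ext (map_add (D.baseHom s) a b)

/-- The scheme `Proj R(X, D)`. -/
abbrev QCartierDivisor.proj {X : Scheme.{u}} [IsIntegral X] (D : QCartierDivisor X) :
    Scheme.{u} :=
  Proj D.grading

/-- The structure morphism `Proj R(X, D) ⟶ Spec k` of a `k`-scheme `X`. -/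
def QCartierDivisor.projToBase {k : Type u} [Field k] {X : Scheme.{u}}
    [IsIntegral X] (D : QCartierDivisor X) (s : X ⟶ Spec (.of k)) :
    D.proj ⟶ Spec (.of k) :=
  Proj.toSpecZero D.grading ≫ Spec.map (CommRingCat.ofHom (D.baseHomZero s))

section ProjectiveSpace

attribute [local instance] MvPolynomial.gradedAlgebra

/-- A morphism `s : X ⟶ Spec k` is projective if it factors through a closed immersion into some
projective space `ℙⁿ = Proj k[x₀, …, xₙ]` over `k`. -/
def IsProjectiveOver {k : Type u} [Field k] {X : Scheme.{u}} (s : X ⟶ Spec (.of k)) : Prop :=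
  ∃ (n : ℕ) (i : X ⟶ Proj (MvPolynomial.homogeneousSubmodule (Fin (n + 1)) k)),
    IsClosedImmersion i ∧
      i ≫ Proj.toSpecZero (MvPolynomial.homogeneousSubmodule (Fin (n + 1)) k) ≫
        Spec.map (CommRingCat.ofHom
          (algebraMap k (MvPolynomial.homogeneousSubmodule (Fin (n + 1)) k 0))) = s

end ProjectiveSpace

/-! ### Group actions and quotients -/

theorem preimage_le_preimage {X Q : Scheme.{u}} {φ : X ⟶ X} {π : X ⟶ Q} (h : φ ≫ π = π)
    (U : Q.Opens) : π ⁻¹ᵁ U ≤ φ ⁻¹ᵁ (π ⁻¹ᵁ U) := by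
  rw [← Scheme.Hom.comp_preimage, h]

/-- `π : X ⟶ Q` is the quotient of the scheme `X` by the action `ρ` of a group `G`, `Q = X/G`:
`π` is invariant, the space of `Q` is the orbit space of `X` with the quotient topology, and `𝒪_Q`
is the sheaf `(π_* 𝒪_X)^G` of invariant functions. So `Q` is the quotient of `X` by `G` as a
ringed space, which determines `π` up to a unique isomorphism. -/
structure IsQuotient {G : Type v} [Group G] {X Q : Scheme.{u}} (ρ : G →* Aut X) (π : X ⟶ Q) :
    Prop where
  comp_eq : ∀ g : G, (ρ g).hom ≫ π = π
  isQuotientMap : Topology.IsQuotientMap π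
  exists_of_eq : ∀ x y : X, π x = π y → ∃ g : G, (ρ g).hom x = y
  injective_app : ∀ U : Q.Opens, Function.Injective (π.app U)
  exists_app_eq : ∀ (U : Q.Opens) (f : Γ(X, π ⁻¹ᵁ U)),
    (∀ g : G, (ρ g).hom.appLE (π ⁻¹ᵁ U) (π ⁻¹ᵁ U) (preimage_le_preimage (comp_eq g) U) f = f) →
      ∃ f' : Γ(Q, U), π.app U f' = f

theorem IsQuotient.isDominant {G : Type v} [Group G] {X Q : Scheme.{u}} {ρ : G →* Aut X}
    {π : X ⟶ Q} (h : IsQuotient ρ π) : IsDominant π :=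
  ⟨h.isQuotientMap.surjective.denseRange⟩

theorem isDominant_aut {X : Scheme.{u}} (a : Aut X) : IsDominant a.hom :=
  have : IsIso a.hom := Iso.isIso_hom a
  inferInstance

theorem CartierDivisor.ext_germ {X : Scheme.{u}} [IsIntegral X] {E F : CartierDivisor X}
    (h : ∀ x, E.germ x = F.germ x) : E = F := by
  cases E; cases F
  congr
  exact funext h

theorem CartierDivisor.pullback_comp {X Y Z : Scheme.{u}} [IsIntegral X] [IsIntegral Y]
    [IsIntegral Z] (E : CartierDivisor Z) (φ : X ⟶ Y) (ψ : Y ⟶ Z) (hφ : IsDominant φ)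
    (hψ : IsDominant ψ) (h : IsDominant (φ ≫ ψ)) :
    (E.pullback ψ hψ).pullback φ hφ = E.pullback (φ ≫ ψ) h := by
  refine CartierDivisor.ext_germ fun x => ?_
  change QuotientGroup.map _ _ _ _ (QuotientGroup.map _ _ _ _ (E.germ (ψ (φ x)))) =
    QuotientGroup.map (localUnits Z (ψ (φ x))) _ _ _ (E.germ (ψ (φ x)))
  obtain ⟨e, he⟩ := QuotientGroup.mk_surjective (E.germ (ψ (φ x)))
  rw [← he]
  simp only [QuotientGroup.map_mk]
  congr 1
  ext
  exact (functionFieldMap_comp φ ψ hφ hψ h e).symm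

theorem CartierDivisor.pullback_congr {X Y : Scheme.{u}} [IsIntegral X] [IsIntegral Y]
    (E : CartierDivisor Y) {φ ψ : X ⟶ Y} (hφ : IsDominant φ) (hψ : IsDominant ψ) (h : φ = ψ) :
    E.pullback φ hφ = E.pullback ψ hψ := by
  subst h
  rfl

/-- A divisor pulled back from a quotient by `G` is `G`-invariant. -/
theorem IsQuotient.pullback_invariant {G : Type v} [Group G] {X Q : Scheme.{u}} [IsIntegral X]
    [IsIntegral Q] {ρ : G →* Aut X} {π : X ⟶ Q} (h : IsQuotient ρ π) (D : QCartierDivisor Q)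
    (hD : IsNormal X ∨ D.index = 1) (g : G) :
    (D.pullback π h.isDominant hD).numerator.pullback (ρ g).hom (isDominant_aut _) =
      (D.pullback π h.isDominant hD).numerator := by
  have hdom := h.isDominant
  have hdom' := isDominant_aut (ρ g)
  exact (D.numerator.pullback_comp (ρ g).hom π (isDominant_aut _) hdom inferInstance).trans
    (D.numerator.pullback_congr _ _ (h.comp_eq g))

/-- Pulling back rational functions along an automorphism which fixes `D` preserves
`H⁰(X, 𝒪_X(mD))`. -/
theorem QCartierDivisor.map_mem_sections {X : Scheme.{u}} [IsIntegral X] (D : QCartierDivisor X)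
    (a : Aut X) (ha : D.numerator.pullback a.hom (isDominant_aut a) = D.numerator) {m : ℕ}
    {f : X.functionField} (hf : f ∈ D.sections m) :
    functionFieldMap a.hom (isDominant_aut a) f ∈ D.sections m := fun x e he => by
  obtain ⟨e', he'⟩ := QuotientGroup.mk_surjective (D.numerator.germ (a.hom x))
  have h1 := functionFieldMap_mem_localRing a.hom (isDominant_aut a) x (hf (a.hom x) e' he')
  rw [map_mul, map_pow, map_pow] at h1
  have h2 : (Units.map (functionFieldMap a.hom (isDominant_aut a)).toMonoidHom e' :
      X.functionFieldˣ ⧸ localUnits X x) = e := by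
    rw [he, ← ha]
    change _ = QuotientGroup.map _ _ _ _ (D.numerator.germ (a.hom x))
    rw [← he']
    rfl
  have h3 := mem_localRing_of_mem_localUnits (QuotientGroup.eq.mp h2)
  have h4 := mul_mem h1 (pow_mem h3 m)
  convert h4 using 1
  rw [mul_assoc, ← mul_pow]
  congr 2
  rw [Units.val_mul, ← mul_assoc]
  exact (by rw [show functionFieldMap a.hom (isDominant_aut a) (e' : X.functionField) =
    ((Units.map (functionFieldMap a.hom (isDominant_aut a)).toMonoidHom e' :
      X.functionFieldˣ) : X.functionField) from rfl, Units.mul_inv, one_mul])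

/-- The graded ring endomorphism of `R(X, D)` given by pulling back sections along an automorphism
of `X` which fixes `D`. -/
def QCartierDivisor.sectionRingMap {X : Scheme.{u}} [IsIntegral X] (D : QCartierDivisor X)
    (a : Aut X) (ha : D.numerator.pullback a.hom (isDominant_aut a) = D.numerator) :
    D.grading →+*ᵍ D.grading where
  toRingHom := ((Polynomial.mapRingHom (functionFieldMap a.hom (isDominant_aut a))).comp
    D.sectionRing.subtype).codRestrict D.sectionRing fun p m => by
      change (Polynomial.map _ (p : Polynomial X.functionField)).coeff m ∈ _
      rw [Polynomial.coeff_map]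
      exact D.map_mem_sections a ha (p.2 m)
  map_mem {m p} hp i hi := by
    change (Polynomial.map _ (p : Polynomial X.functionField)).coeff i = 0
    rw [Polynomial.coeff_map, hp i hi, map_zero]

theorem QCartierDivisor.sectionRingMap_one {X : Scheme.{u}} [IsIntegral X]
    (D : QCartierDivisor X)
    (h : D.numerator.pullback (1 : Aut X).hom (isDominant_aut 1) = D.numerator) :
    D.sectionRingMap 1 h = .id D.grading := by
  refine GradedRingHom.ext fun p => Subtype.ext (Polynomial.ext fun i => ?_)
  change (Polynomial.map _ (p : Polynomial X.functionField)).coeff i = _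
  rw [Polynomial.coeff_map]
  exact functionFieldMap_id _ _

theorem QCartierDivisor.sectionRingMap_mul {X : Scheme.{u}} [IsIntegral X]
    (D : QCartierDivisor X) (a b : Aut X)
    (ha : D.numerator.pullback a.hom (isDominant_aut a) = D.numerator)
    (hb : D.numerator.pullback b.hom (isDominant_aut b) = D.numerator)
    (hab : D.numerator.pullback (a * b).hom (isDominant_aut (a * b)) = D.numerator) :
    D.sectionRingMap (a * b) hab = (D.sectionRingMap b hb).comp (D.sectionRingMap a ha) := by
  refine GradedRingHom.ext fun p => Subtype.ext (Polynomial.ext fun i => ?_)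
  change (Polynomial.map _ (p : Polynomial X.functionField)).coeff i =
    (Polynomial.map _ (Polynomial.map _ (p : Polynomial X.functionField))).coeff i
  simp only [Polynomial.coeff_map]
  exact functionFieldMap_comp b.hom a.hom _ _ _ _

theorem QCartierDivisor.irrelevant_le {X : Scheme.{u}} [IsIntegral X] (D : QCartierDivisor X)
    {G : Type v} [Group G] (ρ : G →* Aut X)
    (h : ∀ g, D.numerator.pullback (ρ g).hom (isDominant_aut _) = D.numerator) (g : G) :
    HomogeneousIdeal.irrelevant D.grading ≤
      (HomogeneousIdeal.irrelevant D.grading).map (D.sectionRingMap (ρ g) (h g)) := by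
  have h1 : D.numerator.pullback (ρ g⁻¹ * ρ g).hom (isDominant_aut _) = D.numerator := by
    rw [← map_mul]; exact h _
  have key : (D.sectionRingMap (ρ g) (h g)).comp (D.sectionRingMap (ρ g⁻¹) (h g⁻¹)) =
      .id D.grading := by
    rw [← D.sectionRingMap_mul (ρ g⁻¹) (ρ g) (h g⁻¹) (h g) h1]
    have h2 : ρ g⁻¹ * ρ g = 1 := by rw [← map_mul, inv_mul_cancel, map_one]
    have : ∀ (a : Aut X) (ha : D.numerator.pullback a.hom (isDominant_aut a) = D.numerator),
        a = 1 → D.sectionRingMap a ha = .id D.grading := by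
      rintro a ha rfl
      exact D.sectionRingMap_one ha
    exact this _ _ h2
  intro p hp
  have hp' : p = D.sectionRingMap (ρ g) (h g) (D.sectionRingMap (ρ g⁻¹) (h g⁻¹) p) :=
    (DFunLike.congr_fun key p).symm
  rw [hp']
  refine Ideal.mem_map_of_mem _ ?_
  change _ ∈ HomogeneousIdeal.irrelevant D.grading
  rw [HomogeneousIdeal.mem_irrelevant_iff] at hp ⊢
  rw [GradedRing.proj_apply] at hp ⊢
  rw [← GradedRingHom.map_directSumDecompose, hp, map_zero]

/-- The action of `G` on `Proj R(X, D)` induced by an action of `G` on `X` which fixes `D`: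
the element `g` acts by `Proj` of the pull-back of sections along `g : X ⟶ X`. -/
def QCartierDivisor.projAction {X : Scheme.{u}} [IsIntegral X] (D : QCartierDivisor X)
    {G : Type v} [Group G] (ρ : G →* Aut X)
    (h : ∀ g, D.numerator.pullback (ρ g).hom (isDominant_aut _) = D.numerator) :
    G →* Aut D.proj :=
  (Aut.unitsEndEquivAut D.proj).toMonoidHom.comp <| MonoidHom.toHomUnits
    { toFun := fun g => (Proj.map (D.sectionRingMap (ρ g) (h g)) (D.irrelevant_le ρ h g) :
        End D.proj)
      map_one' := by
        have : ∀ (a : Aut X) (ha : D.numerator.pullback a.hom (isDominant_aut a) = D.numerator)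
            (hi : HomogeneousIdeal.irrelevant D.grading ≤
              (HomogeneousIdeal.irrelevant D.grading).map (D.sectionRingMap a ha)),
            a = 1 → Proj.map (D.sectionRingMap a ha) hi = 𝟙 D.proj := by
          rintro a ha hi rfl
          rw [← Proj.map_id]
          congr 1
          exact D.sectionRingMap_one ha
        exact this _ _ _ (map_one ρ)
      map_mul' := fun g g' => by
        have : ∀ (a : Aut X) (ha : D.numerator.pullback a.hom (isDominant_aut a) = D.numerator)
            (hi : HomogeneousIdeal.irrelevant D.grading ≤
              (HomogeneousIdeal.irrelevant D.grading).map (D.sectionRingMap a ha)),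
            a = ρ g * ρ g' → Proj.map (D.sectionRingMap a ha) hi =
              Proj.map (D.sectionRingMap (ρ g') (h g')) (D.irrelevant_le ρ h g') ≫
                Proj.map (D.sectionRingMap (ρ g) (h g)) (D.irrelevant_le ρ h g) := by
          rintro a ha hi rfl
          rw [← Proj.map_comp]
          congr 1
          exact D.sectionRingMap_mul _ _ _ _ ha
        exact this _ _ _ (map_mul ρ g g') }

theorem QCartierDivisor.projAction_hom {X : Scheme.{u}} [IsIntegral X] (D : QCartierDivisor X)
    {G : Type v} [Group G] (ρ : G →* Aut X)
    (h : ∀ g, D.numerator.pullback (ρ g).hom (isDominant_aut _) = D.numerator) (g : G) :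
    (D.projAction ρ h g).hom =
      Proj.map (D.sectionRingMap (ρ g) (h g)) (D.irrelevant_le ρ h g) :=
  rfl

end FiniteQuotient

end

/-!
Let `π : X ⟶ Q` be the quotient of `X` by the finite group `G`. The argument has two halves.

*The section ring of the quotient is a ring of invariants.* A `G`-invariant rational function `f`
on `X` has a `G`-stable open domain of definition, which is the preimage of an open set of `Q`;
there `f` is an invariant section of `𝒪_X`, hence a section of `𝒪_Q`. So `f` comes from a rational
function on `Q` that is regular at the images of the points where `f` is regular
(`IsQuotient.exists_functionFieldMap_eq`). Applied to the functions `f ^ n * e ^ m` which define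
`H⁰(𝒪(mD))`, this gives `R(Q, D) = R(X, π^*D)^G` as graded rings
(`IsQuotient.isInvariants_sectionRingPullback`).

*`Proj` of a ring of invariants is a quotient.* Let `A = B^G` be graded rings. Then `B` is integral
over `A`, so that finite generation descends by the Artin–Tate lemma (`IsInvariants.finiteType`),
and primes of `B` over the same prime of `A` are conjugate. It follows that no point of `Proj B`
contracts to a prime containing `A₊` (`IsInvariants.isRelevant`), so that `A → B` induces a morphism
`Proj B ⟶ Proj A` (`projMap`). It is closed and surjective by going up, its fibres are orbits, and
on `D₊(s)` with `s ∈ A` homogeneous an invariant fraction `b / s ^ n` has an invariant numerator,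
because `B` is a domain. So it is the quotient by `G` (`IsInvariants.isQuotient_projMap`).
-/

noncomputable section

namespace FiniteQuotient

/-! ### Morphisms of `Proj` -/

section ProjMap

open HomogeneousIdeal HomogeneousLocalization TopologicalSpace ProjectiveSpectrum Proj
  ProjectiveSpectrum.StructureSheaf

variable {A B σ τ : Type u} [CommRing A] [SetLike σ A] [AddSubgroupClass σ A]
  [CommRing B] [SetLike τ B] [AddSubgroupClass τ B]
  {𝒜 : ℕ → σ} {ℬ : ℕ → τ} [GradedRing 𝒜] [GradedRing ℬ]

/-- A homomorphism `θ` of graded rings is relevant if the preimage of a point of `Proj` under `θ`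
never contains the irrelevant ideal, so that `θ` induces a morphism defined on all of `Proj`.
This is weaker than the condition `ℬ₊ ≤ 𝒜₊.map θ` of `Proj.map`, which fails for the inclusion of
a ring of invariants, as for `k[x²] ⊆ k[x]`. -/
def IsRelevant (θ : 𝒜 →+*ᵍ ℬ) : Prop :=
  ∀ p : ProjectiveSpectrum ℬ, ¬ HomogeneousIdeal.irrelevant 𝒜 ≤ p.asHomogeneousIdeal.comap θ

theorem isRelevant_of_irrelevant_le {θ : 𝒜 →+*ᵍ ℬ}
    (h : HomogeneousIdeal.irrelevant ℬ ≤ (HomogeneousIdeal.irrelevant 𝒜).map θ) :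
    IsRelevant θ :=
  fun p le => p.3 <| h.trans <| map_le_of_le_comap _ le

variable (θ : 𝒜 →+*ᵍ ℬ) (hθ : IsRelevant θ)

/-- The continuous map of projective spectra induced by a relevant graded homomorphism. -/
def projComap : C(ProjectiveSpectrum ℬ, ProjectiveSpectrum 𝒜) where
  toFun p := ⟨p.1.comap θ, p.2.comap θ, hθ p⟩
  continuous_toFun := by
    simp_rw [continuous_iff_isClosed, isClosed_iff_zeroLocus, exists_imp, forall_eq_apply_imp_iff]
    exact fun s ↦ ⟨θ '' s, by ext; simp⟩

/-- The local homomorphism of homogeneous localizations at `p` and at the image of `p`. -/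
def projStalkHom (p : ProjectiveSpectrum ℬ) :
    AtPrime 𝒜 (projComap θ hθ p).asHomogeneousIdeal.toIdeal →+*
      AtPrime ℬ p.asHomogeneousIdeal.toIdeal :=
  localRingHom θ (projComap θ hθ p).asHomogeneousIdeal.toIdeal p.asHomogeneousIdeal.toIdeal rfl

theorem isLocalHom_projStalkHom (p : ProjectiveSpectrum ℬ) :
    IsLocalHom (projStalkHom θ hθ p) where
  map_nonunit x hx := by
    have hval : (projStalkHom θ hθ p x).val =
        Localization.localRingHom _ _ θ.toRingHom rfl x.val := val_localRingHom x
    rw [← isUnit_iff_isUnit_val] at hx ⊢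
    rw [hval] at hx
    exact (Localization.isLocalHom_localRingHom _ _ _ rfl).map_nonunit _ hx

/-- The pull-back of families of germs along the map of projective spectra, the sections of the
structure sheaf being families of germs which are locally given by one fraction. -/
def projComapFun (U : Opens (ProjectiveSpectrum 𝒜)) (V : Opens (ProjectiveSpectrum ℬ))
    (hUV : V.1 ⊆ projComap θ hθ ⁻¹' U.1)
    (s : ∀ x : U, AtPrime 𝒜 x.1.1.1) (y : V) : AtPrime ℬ y.1.1.1 :=
  projStalkHom θ hθ y.1 <| s ⟨projComap θ hθ y.1, hUV y.2⟩

theorem isLocallyFraction_projComapFun (U : Opens (ProjectiveSpectrum 𝒜))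
    (V : Opens (ProjectiveSpectrum ℬ)) (hUV : V.1 ⊆ projComap θ hθ ⁻¹' U.1)
    (s : ∀ x : U, AtPrime 𝒜 x.1.1.1) (hs : (isLocallyFraction 𝒜).pred s) :
    (isLocallyFraction ℬ).pred (projComapFun θ hθ U V hUV s) := by
  rintro ⟨p, hpV⟩
  rcases hs ⟨projComap θ hθ p, hUV hpV⟩ with ⟨W, m, iWU, i, a, b, hb, h_frac⟩
  refine ⟨W.comap (projComap θ hθ) ⊓ V, ⟨m, hpV⟩, Opens.infLERight _ _, i,
    θ.gradedAddHom i a, θ.gradedAddHom i b, fun ⟨q, ⟨hqW, hqV⟩⟩ ↦ hb ⟨_, hqW⟩,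
    fun ⟨q, ⟨hqW, hqV⟩⟩ ↦ ?_⟩
  exact congrArg (projStalkHom θ hθ q) (h_frac ⟨_, hqW⟩)

/-- The pull-back of sections of the structure sheaf along the map of projective spectra. -/
def projComapSections (U : Opens (ProjectiveSpectrum 𝒜)) (V : Opens (ProjectiveSpectrum ℬ))
    (hUV : V.1 ⊆ projComap θ hθ ⁻¹' U.1) :
    (Proj.structureSheaf 𝒜).1.obj (.op U) →+* (Proj.structureSheaf ℬ).1.obj (.op V) where
  toFun s := ⟨projComapFun θ hθ _ _ hUV s.1, isLocallyFraction_projComapFun θ hθ _ _ hUV _ s.2⟩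
  map_one' := Subtype.ext <| funext fun p => map_one (projStalkHom θ hθ p.1)
  map_zero' := Subtype.ext <| funext fun p => map_zero (projStalkHom θ hθ p.1)
  map_add' _ _ := Subtype.ext <| funext fun p => map_add (projStalkHom θ hθ p.1) _ _
  map_mul' _ _ := Subtype.ext <| funext fun p => map_mul (projStalkHom θ hθ p.1) _ _

/-- The morphism of structure sheaves induced by a relevant graded homomorphism. -/
def projSheafMap : (Proj.structureSheaf 𝒜).1 ⟶
    (TopCat.Presheaf.pushforward _ (TopCat.ofHom (projComap θ hθ))).obj
      (Proj.structureSheaf ℬ).1 where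
  app U := CommRingCat.ofHom (R := (Proj.structureSheaf 𝒜).1.obj U)
    (S := (Proj.structureSheaf ℬ).1.obj (.op (U.unop.comap (projComap θ hθ))))
    (projComapSections θ hθ U.unop (U.unop.comap (projComap θ hθ)) Set.Subset.rfl)

/-- The morphism of sheafed spaces induced by a relevant graded homomorphism. -/
def projSheafedSpaceMap : Proj.toSheafedSpace ℬ ⟶ Proj.toSheafedSpace 𝒜 where
  hom :=
    { base := TopCat.ofHom (projComap θ hθ)
      c := projSheafMap θ hθ }

theorem stalkIso'_projSheafedSpaceMap_stalkMap (p : ProjectiveSpectrum ℬ)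
    (x : (Proj.toSheafedSpace 𝒜).presheaf.stalk (projComap θ hθ p)) :
    Proj.stalkIso' ℬ p ((projSheafedSpaceMap θ hθ).hom.stalkMap p x) =
      projStalkHom θ hθ p (Proj.stalkIso' 𝒜 (projComap θ hθ p) x) := by
  obtain ⟨U, hU, s, rfl⟩ := (Proj.toSheafedSpace 𝒜).presheaf.exists_germ_eq x
  erw [PresheafedSpace.stalkMap_germ_apply]
  erw [stalkIso'_germ, stalkIso'_germ]
  rfl

/-- The morphism `Proj ℬ ⟶ Proj 𝒜` induced by a relevant graded homomorphism `𝒜 → ℬ`. -/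
def projMap : Proj ℬ ⟶ Proj 𝒜 where
  __ := (projSheafedSpaceMap θ hθ).hom
  prop p := .mk fun x hx ↦ by
    have h1 : IsUnit (projStalkHom θ hθ p (Proj.stalkIso' 𝒜 (projComap θ hθ p) x)) :=
      stalkIso'_projSheafedSpaceMap_stalkMap θ hθ p x ▸ hx.map (Proj.stalkIso' ℬ p)
    have := isLocalHom_projStalkHom θ hθ p
    exact (MulEquiv.isUnit_map (Proj.stalkIso' 𝒜 (projComap θ hθ p))).mp
      ((isUnit_map_iff (projStalkHom θ hθ p) _).mp h1)

theorem projMap_eq_map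
    (h : HomogeneousIdeal.irrelevant ℬ ≤ (HomogeneousIdeal.irrelevant 𝒜).map θ) :
    projMap θ (isRelevant_of_irrelevant_le h) = Proj.map θ h := by
  with_unfolding_all rfl

theorem projMap_congr {θ θ' : 𝒜 →+*ᵍ ℬ} (hθ : IsRelevant θ) (hθ' : IsRelevant θ')
    (h : θ = θ') : projMap θ hθ = projMap θ' hθ' := by
  subst h
  rfl

theorem projMap_preimage_basicOpen (s : A) :
    projMap θ hθ ⁻¹ᵁ Proj.basicOpen 𝒜 s = Proj.basicOpen ℬ (θ s) := rfl

end ProjMap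

/-! ### Morphisms of `Proj` in terms of fractions -/

section ProjMap

open HomogeneousLocalization TopologicalSpace

variable {A B σ τ : Type u} [CommRing A] [SetLike σ A] [AddSubgroupClass σ A]
  [CommRing B] [SetLike τ B] [AddSubgroupClass τ B]
  {𝒜 : ℕ → σ} {ℬ : ℕ → τ} [GradedRing 𝒜] [GradedRing ℬ]
variable (θ : 𝒜 →+*ᵍ ℬ) (hθ : IsRelevant θ)

section comp

variable {C ψ : Type u} [CommRing C] [SetLike ψ C] [AddSubgroupClass ψ C]
  {𝒞 : ℕ → ψ} [GradedRing 𝒞] (η : ℬ →+*ᵍ 𝒞) (hη : IsRelevant η)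

variable {θ η} in
theorem IsRelevant.comp (hη : IsRelevant η) (hθ : IsRelevant θ) :
    IsRelevant (η.comp θ) :=
  fun p => hθ (projComap η hη p)

theorem projMap_comp : projMap (η.comp θ) (hη.comp hθ) = projMap η hη ≫ projMap θ hθ := by
  refine Scheme.Hom.ext rfl fun U => ?_
  ext s
  refine Subtype.ext (funext fun p => HomogeneousLocalization.val_injective _ ?_)
  change (projComapFun (η.comp θ) _ U _ Set.Subset.rfl s.1 p).val =
    (projComapFun η hη _ _ Set.Subset.rfl (projComapFun θ hθ U _ Set.Subset.rfl s.1) p).val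
  unfold projComapFun
  unfold projStalkHom
  obtain ⟨c, hc⟩ := HomogeneousLocalization.mk_surjective
    (s.1 ⟨projComap θ hθ (projComap η hη p.1), p.2⟩)
  erw [← hc]
  rfl

end comp

/-- The effect of `projMap θ` on the sections `a / s ^ n` over `D₊(s)`. -/
theorem projMap_appLE_awayToSection {s : A} {t : B} (h : θ s = t)
    (e : Proj.basicOpen ℬ t ≤ projMap θ hθ ⁻¹ᵁ Proj.basicOpen 𝒜 s) {n d : ℕ} (hs : s ∈ 𝒜 d)
    (ht : t ∈ ℬ d) {a : A} (ha : a ∈ 𝒜 (n • d)) (ha' : θ a ∈ ℬ (n • d)) :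
    (projMap θ hθ).appLE (Proj.basicOpen 𝒜 s) (Proj.basicOpen ℬ t) e
      (Proj.awayToSection 𝒜 s (Away.mk 𝒜 hs n a ha)) =
      Proj.awayToSection ℬ t (Away.mk ℬ ht n (θ a) ha') := by
  subst h
  refine Subtype.ext <| funext fun p ↦ ?_
  change HomogeneousLocalization.mk _ = .mk _
  ext
  simp

theorem awayToSection_comp_projMap_appLE {d : ℕ} {s : A} (hs : s ∈ 𝒜 d) :
    Proj.awayToSection 𝒜 s ≫
      (projMap θ hθ).appLE (Proj.basicOpen 𝒜 s) (Proj.basicOpen ℬ (θ s))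
        (projMap_preimage_basicOpen θ hθ s).ge =
    CommRingCat.ofHom (Away.map θ s : Away 𝒜 s →+* Away ℬ (θ s)) ≫
      Proj.awayToSection ℬ (θ s) := by
  ext x
  obtain ⟨n, x, hx, rfl⟩ := x.mk_surjective _ hs
  refine Subtype.ext <| funext fun p ↦ ?_
  change HomogeneousLocalization.mk _ = .mk _
  ext
  simp

/-- On `D₊(θ s)`, the morphism `projMap θ` is `Spec` of `(A_s)₀ → (B_{θ s})₀`. -/
theorem awayι_comp_projMap {d : ℕ} (hd : 0 < d) (s : A) (hs : s ∈ 𝒜 d) :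
    Proj.awayι ℬ (θ s) (θ.2 hs) hd ≫ projMap θ hθ =
      Spec.map (CommRingCat.ofHom (Away.map θ s)) ≫ Proj.awayι 𝒜 s hs hd := by
  have h1 : (Proj.basicOpen ℬ (θ s)).ι ≫ projMap θ hθ =
      (projMap θ hθ).resLE (Proj.basicOpen 𝒜 s) (Proj.basicOpen ℬ (θ s))
        (projMap_preimage_basicOpen θ hθ s).ge ≫
        (Proj.basicOpen 𝒜 s).ι := (Scheme.Hom.resLE_comp_ι _ _).symm
  have h2 : Proj.basicOpenToSpec ℬ (θ s) ≫ Spec.map (CommRingCat.ofHom (Away.map θ s)) =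
      (projMap θ hθ).resLE (Proj.basicOpen 𝒜 s) (Proj.basicOpen ℬ (θ s))
        (projMap_preimage_basicOpen θ hθ s).ge ≫
        Proj.basicOpenToSpec 𝒜 s := by
    rw [Proj.basicOpenToSpec, Proj.basicOpenToSpec, Category.assoc, ← Spec.map_comp,
      ← awayToSection_comp_projMap_appLE θ hθ hs, Spec.map_comp, ← Category.assoc,
      Scheme.Opens.toSpecΓ_SpecMap_appLE, Category.assoc]
  rw [Proj.awayι, Category.assoc, h1, Iso.inv_comp_eq, Proj.basicOpenIsoSpec_hom,
    ← Category.assoc, h2, Proj.awayι, ← Proj.basicOpenIsoSpec_hom 𝒜 s hs hd, Category.assoc,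
    Iso.hom_inv_id_assoc]

variable {θ} in
theorem IsRelevant.exists_mem_basicOpen (hθ : IsRelevant θ) (p : Proj ℬ) :
    ∃ (d : ℕ) (s : A), 0 < d ∧ s ∈ 𝒜 d ∧ p ∈ Proj.basicOpen ℬ (θ s) := by
  by_contra! h
  refine hθ p ((HomogeneousIdeal.toIdeal_irrelevant_le _).mpr fun d hd s hs => ?_)
  simpa using h d s hd hs

variable {θ} in
/-- The open sets `D₊(θ s)`, for `s` homogeneous of positive degree, cover `Proj ℬ`. -/
def IsRelevant.affineOpenCover (hθ : IsRelevant θ) : (Proj ℬ).AffineOpenCover where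
  I₀ := Σ' (d : ℕ) (s : A), 0 < d ∧ s ∈ 𝒜 d
  X i := .of (Away ℬ (θ i.2.1))
  f i := Proj.awayι ℬ (θ i.2.1) (θ.2 i.2.2.2) i.2.2.1
  idx p := ⟨_, _, (hθ.exists_mem_basicOpen p).choose_spec.choose_spec.1,
    (hθ.exists_mem_basicOpen p).choose_spec.choose_spec.2.1⟩
  covers p := by
    change p ∈ (Proj.awayι ℬ _ _ _).opensRange
    rw [Proj.opensRange_awayι]
    exact (hθ.exists_mem_basicOpen p).choose_spec.choose_spec.2.2

theorem projMap_toSpecZero {K : Type u} [CommRing K] (i : K →+* 𝒜 0) (j : K →+* ℬ 0)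
    (h : ∀ c, θ (i c) = j c) :
    projMap θ hθ ≫ Proj.toSpecZero 𝒜 ≫ Spec.map (CommRingCat.ofHom i) =
      Proj.toSpecZero ℬ ≫ Spec.map (CommRingCat.ofHom j) := by
  refine hθ.affineOpenCover.openCover.hom_ext _ _ fun ⟨d, s, hd, hs⟩ => ?_
  change Proj.awayι ℬ (θ s) (θ.2 hs) hd ≫ _ = Proj.awayι ℬ (θ s) (θ.2 hs) hd ≫ _
  rw [← Category.assoc, awayι_comp_projMap, Category.assoc, Proj.awayι_toSpecZero_assoc,
    Proj.awayι_toSpecZero_assoc]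
  simp only [← Spec.map_comp, ← CommRingCat.ofHom_comp]
  congr 2
  ext c
  · change (HomogeneousLocalization.Away.map θ s (HomogeneousLocalization.mk _)).val =
      (HomogeneousLocalization.mk _).val
    simp [HomogeneousLocalization.Away.map, HomogeneousLocalization.map_mk, h]
  · exact hs

end ProjMap


/-! ### Rings of invariants of a finite group -/

section Invariants

/-- The homomorphism `θ : A → B` identifies `A` with the ring of invariants of `B` under the
endomorphisms `σ g`. The family `σ` is an action of `G` from the right, as is the pull-back of
functions along an action of `G` on a space from the left. -/
structure IsInvariants {G : Type*} [Group G] {A B : Type*} [CommRing A] [CommRing B]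
    (θ : A →+* B) (σ : G → B →+* B) : Prop where
  injective : Function.Injective θ
  one_apply : ∀ b, σ 1 b = b
  mul_apply : ∀ g h b, σ (g * h) b = σ h (σ g b)
  apply_map : ∀ g a, σ g (θ a) = θ a
  exists_of_forall : ∀ b, (∀ g, σ g b = b) → ∃ a, θ a = b

namespace IsInvariants

variable {G : Type*} [Group G] {A B : Type*} [CommRing A] [CommRing B]
  {θ : A →+* B} {σ : G → B →+* B}

/-- The action of `G` from the left by the inverses. -/
@[reducible] def mulSemiringAction (h : IsInvariants θ σ) : MulSemiringAction G B where
  smul g b := σ g⁻¹ b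
  one_smul b := by change σ 1⁻¹ b = b; rw [inv_one, h.one_apply]
  mul_smul g g' b := by
    change σ (g * g')⁻¹ b = σ g⁻¹ (σ g'⁻¹ b)
    rw [mul_inv_rev, h.mul_apply]
  smul_zero g := map_zero (σ g⁻¹)
  smul_add g := map_add (σ g⁻¹)
  smul_one g := map_one (σ g⁻¹)
  smul_mul g := map_mul (σ g⁻¹)

theorem isInvariant (h : IsInvariants θ σ) :
    letI := θ.toAlgebra
    letI := h.mulSemiringAction
    Algebra.IsInvariant A B G := by
  let := θ.toAlgebra
  let := h.mulSemiringAction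
  refine ⟨fun b hb => h.exists_of_forall b fun g => ?_⟩
  have := hb g⁻¹
  change σ g⁻¹⁻¹ b = b at this
  rwa [inv_inv] at this

theorem isIntegral [Finite G] (h : IsInvariants θ σ) : θ.IsIntegral := by
  let := θ.toAlgebra
  let := h.mulSemiringAction
  have := h.isInvariant
  exact (Algebra.IsInvariant.isIntegral A B G).isIntegral

/-- Two primes of `B` with the same contraction to the invariants are conjugate. -/
theorem exists_comap_eq [Finite G] (h : IsInvariants θ σ) (P Q : Ideal B) [P.IsPrime]
    [Q.IsPrime] (hPQ : P.comap θ = Q.comap θ) : ∃ g, P.comap (σ g) = Q := by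
  let := θ.toAlgebra
  let := h.mulSemiringAction
  have := h.isInvariant
  have : SMulCommClass G A B := ⟨fun g a b => by
    change σ g⁻¹ (θ a * b) = θ a * σ g⁻¹ b
    rw [map_mul, h.apply_map]⟩
  obtain ⟨g, rfl⟩ := Algebra.IsInvariant.exists_smul_of_under_eq A B G P Q hPQ
  refine ⟨g, ?_⟩
  ext b
  rw [Ideal.mem_pointwise_smul_iff_inv_smul_mem, Ideal.mem_comap]
  change _ ↔ σ g⁻¹⁻¹ b ∈ P
  rw [inv_inv]

/-- Noether: the ring of invariants of a finite group acting on a finitely generated algebra over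
a field is finitely generated. Since `B` is finite over `A`, this is the Artin–Tate lemma. -/
theorem finiteType [Finite G] (h : IsInvariants θ σ) {K : Type*} [Field K] (i : K →+* A)
    (hB : (θ.comp i).FiniteType) : i.FiniteType := by
  let := θ.toAlgebra
  let := i.toAlgebra
  let := (θ.comp i).toAlgebra
  have : IsScalarTower K A B := .of_algebraMap_eq fun _ => rfl
  have hKB : Algebra.FiniteType K B := hB
  have : Algebra.FiniteType A B := .of_restrictScalars_finiteType K A B
  have : Algebra.IsIntegral A B := ⟨h.isIntegral⟩
  have : Module.Finite A B := Algebra.IsIntegral.finite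
  exact ⟨fg_of_fg_of_fg K A B hKB.out Module.Finite.fg_top h.injective⟩

end IsInvariants

end Invariants

/-! ### `Proj` of a ring of invariants: the underlying space -/

section GradedInvariants

open HomogeneousLocalization

variable {A B σ τ : Type u} [CommRing A] [SetLike σ A] [AddSubgroupClass σ A]
  [CommRing B] [SetLike τ B] [AddSubgroupClass τ B]
  {𝒜 : ℕ → σ} {ℬ : ℕ → τ} [GradedRing 𝒜] [GradedRing ℬ]
  {G : Type v} [Group G] {θ : 𝒜 →+*ᵍ ℬ} {α : G → ℬ →+*ᵍ ℬ}

theorem mem_grading_of_map_mem (hθ : Function.Injective θ) {d : ℕ} {a : A} (ha : θ a ∈ ℬ d) :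
    a ∈ 𝒜 d := by
  have h : ((DirectSum.decompose 𝒜 a d : 𝒜 d) : A) = a := hθ <| by
    rw [GradedRingHom.map_directSumDecompose, DirectSum.decompose_of_mem_same _ ha]
  exact h ▸ SetLike.coe_mem _

/-- A homogeneous prime `P` of `B` whose contraction contains `A₊` contains `B₊`: the
prime `P' = {b | b₀ ∈ P} ⊇ P + B₊` has the same contraction, so that it is conjugate to `P`. -/
theorem IsInvariants.isRelevant [Finite G]
    (h : IsInvariants θ.toRingHom fun g => (α g).toRingHom) : IsRelevant θ := by
  intro P hP
  have := P.isPrime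
  -- `projZeroRingHom` is the homomorphism `b ↦ b₀`, so its preimage `P'` of `P` is prime.
  have hP' : (P.asHomogeneousIdeal.toIdeal.comap (GradedRing.projZeroRingHom ℬ)).comap
      θ.toRingHom = P.asHomogeneousIdeal.toIdeal.comap θ.toRingHom := by
    ext a
    have h1 : GradedRing.projZeroRingHom ℬ (θ a) = θ (GradedRing.projZeroRingHom 𝒜 a) := by
      simp [GradedRing.projZeroRingHom_apply, GradedRingHom.map_directSumDecompose]
    have h2 : a - GradedRing.projZeroRingHom 𝒜 a ∈ HomogeneousIdeal.irrelevant 𝒜 := by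
      rw [HomogeneousIdeal.mem_irrelevant_iff]
      simp [GradedRing.proj_apply, GradedRing.projZeroRingHom_apply]
    have h3 : θ (a - GradedRing.projZeroRingHom 𝒜 a) ∈ P.asHomogeneousIdeal.toIdeal := hP h2
    change GradedRing.projZeroRingHom ℬ (θ a) ∈ P.asHomogeneousIdeal.toIdeal ↔
      θ a ∈ P.asHomogeneousIdeal.toIdeal
    rw [h1]
    rw [map_sub] at h3
    exact ⟨fun h => by simpa using add_mem h3 h, fun h => by simpa using sub_mem h h3⟩
  obtain ⟨g, hg⟩ := h.exists_comap_eq _ _ hP'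
  refine P.not_irrelevant_le ((HomogeneousIdeal.toIdeal_irrelevant_le _).mpr fun d hd b hb => ?_)
  change b ∈ P.asHomogeneousIdeal.toIdeal
  rw [← hg]
  change GradedRing.projZeroRingHom ℬ (α g b) ∈ P.asHomogeneousIdeal.toIdeal
  rw [GradedRing.projZeroRingHom_apply, DirectSum.decompose_of_mem_ne ℬ
    (show α g b ∈ ℬ d from (α g).2 hb) hd.ne']
  exact zero_mem _

/-- Going up, for homogeneous ideals: a point of `Proj 𝒜` which contains the contraction of a
homogeneous ideal `I` lifts to a point of `Proj ℬ` which contains `I`. -/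
theorem exists_projComap_eq (hθ : IsRelevant θ) (hint : θ.toRingHom.IsIntegral)
    (p : ProjectiveSpectrum 𝒜) (I : HomogeneousIdeal ℬ)
    (hI : ∀ a, θ a ∈ I → a ∈ p.asHomogeneousIdeal) :
    ∃ P : ProjectiveSpectrum ℬ, I ≤ P.asHomogeneousIdeal ∧ projComap θ hθ P = p := by
  let := θ.toRingHom.toAlgebra
  have : Algebra.IsIntegral A B := ⟨hint⟩
  have := p.isPrime
  obtain ⟨Q, hIQ, hQ, hQp⟩ := Ideal.exists_ideal_over_prime_of_isIntegral
    p.asHomogeneousIdeal.toIdeal I.toIdeal hI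
  have hmem : ∀ a, θ a ∈ Q ↔ a ∈ p.asHomogeneousIdeal := fun a => by
    change _ ↔ a ∈ p.asHomogeneousIdeal.toIdeal
    rw [← hQp]
    rfl
  -- `Q` need not be homogeneous, but its homogeneous core is prime and has the same contraction.
  have hcore : ∀ a, θ a ∈ Q.homogeneousCore ℬ ↔ a ∈ p.asHomogeneousIdeal := fun a => by
    refine ⟨fun ha => (hmem a).mp (Ideal.toIdeal_homogeneousCore_le ℬ Q ha), fun ha => ?_⟩
    classical
    rw [← DirectSum.sum_support_decompose 𝒜 a, map_sum]
    refine sum_mem fun i _ => ?_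
    exact Ideal.mem_homogeneousCore_of_homogeneous_of_mem ⟨i, θ.2 (SetLike.coe_mem _)⟩
      ((hmem _).mpr (p.asHomogeneousIdeal.2 i ha))
  refine ⟨⟨Q.homogeneousCore ℬ, hQ.homogeneousCore, fun hle => ?_⟩, ?_, ?_⟩
  · refine p.not_irrelevant_le ((HomogeneousIdeal.toIdeal_irrelevant_le _).mpr
      fun d hd a ha => (hcore a).mp (hle ?_))
    exact HomogeneousIdeal.mem_irrelevant_of_mem ℬ hd (θ.2 ha)
  · change I.toIdeal ≤ (Q.homogeneousCore ℬ).toIdeal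
    rw [← I.toIdeal_homogeneousCore_eq_self]
    exact Ideal.homogeneousCore_mono ℬ hIQ
  · refine ProjectiveSpectrum.ext (HomogeneousIdeal.ext (Ideal.ext hcore))

theorem surjective_projComap (hθ : IsRelevant θ) (hint : θ.toRingHom.IsIntegral)
    (hinj : Function.Injective θ) : Function.Surjective (projComap θ hθ) := fun p => by
  obtain ⟨P, -, hP⟩ := exists_projComap_eq hθ hint p ⊥ fun a ha => by
    have : θ a = 0 := ha
    rw [(map_eq_zero_iff θ hinj).mp this]
    exact zero_mem _
  exact ⟨P, hP⟩

theorem isClosedMap_projComap (hθ : IsRelevant θ) (hint : θ.toRingHom.IsIntegral) :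
    IsClosedMap (projComap θ hθ) := by
  intro Z hZ
  rw [← hZ.closure_eq, ← ProjectiveSpectrum.zeroLocus_vanishingIdeal_eq_closure,
    ProjectiveSpectrum.isClosed_iff_zeroLocus]
  -- The image of `V₊(I)` is the closed set defined by the contraction of `I`.
  set I := ProjectiveSpectrum.vanishingIdeal Z
  refine ⟨{a | θ a ∈ I}, Set.Subset.antisymm ?_ fun p hp => ?_⟩
  · rintro _ ⟨P, hP, rfl⟩ a ha
    exact hP ha
  · obtain ⟨P, hIP, rfl⟩ := exists_projComap_eq hθ hint p I fun a ha => hp ha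
    exact ⟨P, hIP, rfl⟩

theorem IsInvariants.exists_projComap_eq_of_eq [Finite G]
    (h : IsInvariants θ.toRingHom fun g => (α g).toRingHom) (hθ : IsRelevant θ)
    (hα : ∀ g, IsRelevant (α g)) (x y : ProjectiveSpectrum ℬ)
    (hxy : projComap θ hθ x = projComap θ hθ y) : ∃ g, projComap (α g) (hα g) x = y := by
  have := x.isPrime
  have := y.isPrime
  obtain ⟨g, hg⟩ := h.exists_comap_eq x.asHomogeneousIdeal.toIdeal y.asHomogeneousIdeal.toIdeal
    congr(($hxy).asHomogeneousIdeal.toIdeal)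
  exact ⟨g, ProjectiveSpectrum.ext (HomogeneousIdeal.ext hg)⟩

end GradedInvariants


/-! ### `Proj` of a ring of invariants: the structure sheaf -/

/-- If pulling back sections along `π` is injective, then the sections of `X` which are pulled back
from `Q` can be recognized locally on `Q`. -/
theorem exists_app_eq_of_locally {X Q : Scheme.{u}} (π : X ⟶ Q)
    (hinj : ∀ U : Q.Opens, Function.Injective (π.app U)) (U : Q.Opens) (f : Γ(X, π ⁻¹ᵁ U))
    (h : ∀ x ∈ U, ∃ (V : Q.Opens) (hV : V ≤ U), x ∈ V ∧ ∃ t : Γ(Q, V),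
      π.app V t = X.presheaf.map (homOfLE (π.preimage_mono hV)).op f) :
    ∃ f', π.app U f' = f := by
  choose! V hVU hxV t ht using h
  have hres : ∀ (V W : Q.Opens) (hVW : V ≤ W) (s : Γ(Q, W)),
      π.app V (Q.presheaf.map (homOfLE hVW).op s) =
        X.presheaf.map (homOfLE (π.preimage_mono hVW)).op (π.app W s) := fun V W hVW s =>
    ConcreteCategory.congr_hom (π.naturality (homOfLE hVW).op) s
  have hmap : ∀ (V W T : X.Opens) (h1 : V ≤ W) (h2 : W ≤ T) (s : Γ(X, T)),
      X.presheaf.map (homOfLE h1).op (X.presheaf.map (homOfLE h2).op s) =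
        X.presheaf.map (homOfLE (h1.trans h2)).op s := fun V W T h1 h2 s => by
    rw [← CommRingCat.comp_apply, ← Functor.map_comp]
    rfl
  have hcov : U ≤ ⨆ x : U, V x := fun x hx =>
    TopologicalSpace.Opens.mem_iSup.mpr ⟨⟨x, hx⟩, hxV x hx⟩
  obtain ⟨f', hf', -⟩ := Q.sheaf.existsUnique_gluing' (fun x : U => V x) U
    (fun x => homOfLE (hVU x x.2)) hcov (fun x => t x) fun x y => by
      apply hinj
      refine (hres _ _ inf_le_left _).trans (Eq.trans ?_ (hres _ _ inf_le_right _).symm)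
      rw [ht x x.2, ht y y.2, hmap, hmap]
  refine ⟨f', X.sheaf.eq_of_locally_eq' (fun x : U => π ⁻¹ᵁ V x) (π ⁻¹ᵁ U)
    (fun x => homOfLE (π.preimage_mono (hVU x x.2))) (fun y hy => ?_) _ _ fun x => ?_⟩
  · exact TopologicalSpace.Opens.mem_iSup.mpr ⟨⟨π y, hy⟩, hxV _ hy⟩
  · refine (hres _ _ (hVU x x.2) f').symm.trans (Eq.trans ?_ (ht x x.2))
    congr 1
    exact hf' x

theorem appLE_res_eq_of_appLE_eq {X : Scheme.{u}} (φ : X ⟶ X) {V W : X.Opens} (h : V ≤ W)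
    (eW : W ≤ φ ⁻¹ᵁ W) (eV : V ≤ φ ⁻¹ᵁ V) {f : Γ(X, W)} (hf : φ.appLE W W eW f = f) :
    φ.appLE V V eV (X.presheaf.map (homOfLE h).op f) = X.presheaf.map (homOfLE h).op f := by
  conv_rhs => rw [← hf]
  rw [← CommRingCat.comp_apply, ← CommRingCat.comp_apply, Scheme.Hom.map_appLE,
    Scheme.Hom.appLE_map]

section GradedInvariants

open HomogeneousLocalization

variable {A B σ τ : Type u} [CommRing A] [SetLike σ A] [AddSubgroupClass σ A]
  [CommRing B] [SetLike τ B] [AddSubgroupClass τ B]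
  {𝒜 : ℕ → σ} {ℬ : ℕ → τ} [GradedRing 𝒜] [GradedRing ℬ]
  {G : Type v} [Group G] {θ : 𝒜 →+*ᵍ ℬ} {α : G → ℬ →+*ᵍ ℬ}

theorem projStalkHom_injective [IsDomain B] (hinj : Function.Injective θ) (hθ : IsRelevant θ)
    (P : ProjectiveSpectrum ℬ) : Function.Injective (projStalkHom θ hθ P) := by
  rw [injective_iff_map_eq_zero]
  intro x hx
  obtain ⟨c, rfl⟩ := HomogeneousLocalization.mk_surjective x
  apply HomogeneousLocalization.val_injective
  have : Localization.mk (θ c.num) ⟨θ c.den, c.den_mem⟩ =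
      (0 : Localization P.asHomogeneousIdeal.toIdeal.primeCompl) :=
    (congrArg HomogeneousLocalization.val hx).trans HomogeneousLocalization.val_zero
  simp only [val_mk, val_zero, Localization.mk_eq_mk', IsLocalization.mk'_eq_zero_iff] at this ⊢
  obtain ⟨m, hm⟩ := this
  refine ⟨1, ?_⟩
  have hm0 : (m : B) ≠ 0 := fun h0 => m.2 (h0 ▸ zero_mem P.asHomogeneousIdeal.toIdeal)
  have h2 := (mul_eq_zero.mp hm).resolve_left hm0
  rw [OneMemClass.coe_one, one_mul]
  exact hinj (by simpa using h2)

theorem projMap_app_injective [IsDomain B] (hinj : Function.Injective θ) (hθ : IsRelevant θ)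
    (hsurj : Function.Surjective (projComap θ hθ)) (U : (Proj 𝒜).Opens) :
    Function.Injective ((projMap θ hθ).app U) := by
  intro s t hst
  refine Subtype.ext (funext fun ⟨p, hp⟩ => ?_)
  obtain ⟨P, rfl⟩ := hsurj p
  have h1 := congr_fun (congr_arg Subtype.val hst) ⟨P, hp⟩
  exact projStalkHom_injective hinj hθ P h1

theorem eq_of_awayMk_eq [IsDomain B] {d : ℕ} {s : B} (hs : s ∈ ℬ d) (hs0 : s ≠ 0) {n : ℕ}
    {a b : B} (ha : a ∈ ℬ (n • d)) (hb : b ∈ ℬ (n • d))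
    (h : Away.mk ℬ hs n a ha = Away.mk ℬ hs n b hb) : a = b := by
  have := congrArg HomogeneousLocalization.val h
  simp only [Away.val_mk, Localization.mk_eq_mk_iff, Localization.r_iff_exists] at this
  obtain ⟨⟨_, k, rfl⟩, hc⟩ := this
  exact mul_left_cancel₀ (pow_ne_zero n hs0) (mul_left_cancel₀ (pow_ne_zero k hs0) hc)

theorem awayToSection_injective {d : ℕ} {s : B} (hs : s ∈ ℬ d) (hd : 0 < d) :
    Function.Injective (Proj.awayToSection ℬ s) :=
  (Proj.basicOpenIsoAway ℬ s hs hd).commRingCatIsoToRingEquiv.injective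

theorem awayToSection_surjective {d : ℕ} {s : B} (hs : s ∈ ℬ d) (hd : 0 < d) :
    Function.Surjective (Proj.awayToSection ℬ s) :=
  (Proj.basicOpenIsoAway ℬ s hs hd).commRingCatIsoToRingEquiv.surjective

/-- The sets `D₊(s)` with `s` homogeneous of positive degree are a basis of the topology. -/
theorem exists_homogeneous_mem_basicOpen_le (U : (Proj 𝒜).Opens) (p : Proj 𝒜) (hp : p ∈ U) :
    ∃ (d : ℕ) (s : A), 0 < d ∧ s ∈ 𝒜 d ∧ p ∈ Proj.basicOpen 𝒜 s ∧ Proj.basicOpen 𝒜 s ≤ U := by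
  obtain ⟨_, ⟨_, ⟨a, rfl⟩, rfl⟩, hpa, haU⟩ :=
    (Proj.isBasis_basicOpen 𝒜).exists_subset_of_mem_open hp U.isOpen
  have hpa' : p ∈ Proj.basicOpen 𝒜 a := hpa
  rw [Proj.basicOpen_eq_iSup_proj] at hpa'
  obtain ⟨i, hi⟩ := TopologicalSpace.Opens.mem_iSup.mp hpa'
  -- The component `aᵢ` may have degree `0`; multiplying by `s` makes the degree positive.
  obtain ⟨d, s, hd, hs, hps⟩ : ∃ (d : ℕ) (s : A), 0 < d ∧ s ∈ 𝒜 d ∧ p ∈ Proj.basicOpen 𝒜 s := by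
    by_contra! h
    refine p.not_irrelevant_le ((HomogeneousIdeal.toIdeal_irrelevant_le _).mpr fun d hd s hs => ?_)
    simpa using h d s hd hs
  refine ⟨i + d, GradedRing.proj 𝒜 i a * s, by omega,
    SetLike.mul_mem_graded (SetLike.coe_mem _) hs, ?_, ?_⟩
  · rw [Proj.basicOpen_mul]
    exact ⟨hi, hps⟩
  · rw [Proj.basicOpen_mul]
    refine inf_le_left.trans (le_trans ?_ (show Proj.basicOpen 𝒜 a ≤ U from haU))
    rw [Proj.basicOpen_eq_iSup_proj 𝒜 a]
    exact le_iSup (fun i => Proj.basicOpen 𝒜 (GradedRing.proj 𝒜 i a)) i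

/-- `Proj` of the ring of invariants of a domain is the quotient of `Proj`. An invariant section is
a fraction `b / s ^ n` on each `D₊(θ s)`; since `s` is invariant and nonzero, so is `b`, which
therefore comes from `A`. -/
theorem IsInvariants.isQuotient_projMap [Finite G] [IsDomain B]
    (h : IsInvariants θ.toRingHom fun g => (α g).toRingHom) (hθ : IsRelevant θ)
    (hα : ∀ g, IsRelevant (α g)) (ρ : G →* Aut (Proj ℬ))
    (hρ : ∀ g, (ρ g).hom = projMap (α g) (hα g)) : IsQuotient ρ (projMap θ hθ) := by
  have hinj : Function.Injective θ := h.injective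
  have hsurj := surjective_projComap hθ h.isIntegral hinj
  have hcomp : ∀ g, (ρ g).hom ≫ projMap θ hθ = projMap θ hθ := fun g => by
    rw [hρ, ← projMap_comp]
    exact projMap_congr _ _ (GradedRingHom.ext fun a => h.apply_map g a)
  have happ := projMap_app_injective hinj hθ hsurj
  refine ⟨hcomp, (isClosedMap_projComap hθ h.isIntegral).isQuotientMap
    (projComap θ hθ).continuous hsurj, fun x y hxy => ?_, happ, fun U f hf => ?_⟩
  · obtain ⟨g, hg⟩ := h.exists_projComap_eq_of_eq hθ hα x y hxy
    exact ⟨g, by rw [hρ]; exact hg⟩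
  · refine exists_app_eq_of_locally _ happ U f fun p hp => ?_
    obtain ⟨d, s, hd, hs, hps, hsU⟩ := exists_homogeneous_mem_basicOpen_le U p hp
    refine ⟨_, hsU, hps, ?_⟩
    have hs0 : θ s ≠ 0 := fun h0 => hps (by
      rw [(map_eq_zero_iff θ hinj).mp h0]; exact zero_mem _)
    obtain ⟨z, hz⟩ := awayToSection_surjective (θ.2 hs) hd
      ((Proj ℬ).presheaf.map (homOfLE ((projMap θ hθ).preimage_mono hsU)).op f)
    obtain ⟨n, b, hb, rfl⟩ := z.mk_surjective _ (θ.2 hs)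
    obtain ⟨a, rfl⟩ : ∃ a, θ a = b := by
      refine h.exists_of_forall b fun g => ?_
      have e : Proj.basicOpen ℬ (θ s) ≤ (ρ g).hom ⁻¹ᵁ Proj.basicOpen ℬ (θ s) := by
        rw [hρ, projMap_preimage_basicOpen]
        exact le_of_eq (congr_arg _ (h.apply_map g s).symm)
      have h1 : (ρ g).hom.appLE _ _ e ((Proj ℬ).presheaf.map
          (homOfLE ((projMap θ hθ).preimage_mono hsU)).op f) =
          (Proj ℬ).presheaf.map (homOfLE ((projMap θ hθ).preimage_mono hsU)).op f :=
        appLE_res_eq_of_appLE_eq _ _ _ _ (hf g)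
      rw [← hz] at h1
      have h2 : (ρ g).hom.appLE _ _ e (Proj.awayToSection ℬ (θ s) (Away.mk ℬ (θ.2 hs) n b hb)) =
          Proj.awayToSection ℬ (θ s) (Away.mk ℬ (θ.2 hs) n (α g b) ((α g).2 hb)) := by
        revert e
        rw [hρ]
        intro e _
        exact projMap_appLE_awayToSection (α g) (hα g) (h.apply_map g s) e (θ.2 hs) (θ.2 hs) hb _
      exact eq_of_awayMk_eq (θ.2 hs) hs0 _ _
        (awayToSection_injective (θ.2 hs) hd (h2.symm.trans h1))
    have ha : a ∈ 𝒜 (n • d) := mem_grading_of_map_mem hinj hb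
    refine ⟨Proj.awayToSection 𝒜 s (Away.mk 𝒜 hs n a ha), ?_⟩
    rw [← Scheme.Hom.appLE_eq_app]
    exact (projMap_appLE_awayToSection θ hθ rfl le_rfl hs (θ.2 hs) ha hb).trans hz

end GradedInvariants


/-! ### Invariant rational functions -/

theorem mem_localRing_iff {X : Scheme.{u}} [IsIntegral X] {x : X} {f : X.functionField} :
    f ∈ localRing X x ↔ ∃ (U : X.Opens) (hx : x ∈ U) (s : Γ(X, U)),
      algebraMap _ X.functionField (X.presheaf.germ U x hx s) = f := by
  constructor
  · rintro ⟨a, rfl⟩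
    obtain ⟨U, hx, s, rfl⟩ := X.presheaf.exists_germ_eq a
    exact ⟨U, hx, s, rfl⟩
  · rintro ⟨U, hx, s, rfl⟩
    exact ⟨_, rfl⟩

/-- A rational function which is regular at all points of `U` is a section over `U`. -/
theorem exists_germToFunctionField_eq {X : Scheme.{u}} [IsIntegral X] (U : X.Opens) [Nonempty U]
    (f : X.functionField) (hf : ∀ x ∈ U, f ∈ localRing X x) :
    ∃ s : Γ(X, U), X.germToFunctionField U s = f := by
  have h : ∀ x : U, ∃ (V : X.Opens) (_ : V ≤ U) (hV : Nonempty V) (s : Γ(X, V)), x.1 ∈ V ∧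
      X.germToFunctionField V s = f := fun x => by
    obtain ⟨V, hx, s, rfl⟩ := mem_localRing_iff.mp (hf x x.2)
    have hxVU : x.1 ∈ V ⊓ U := ⟨hx, x.2⟩
    have hne : Nonempty (V ⊓ U : X.Opens) := ⟨⟨x.1, hxVU⟩⟩
    refine ⟨V ⊓ U, inf_le_right, hne, X.presheaf.map (homOfLE inf_le_left).op s, hxVU, ?_⟩
    rw [← Scheme.algebraMap_germ_eq_germToFunctionField (X := X) (U := V ⊓ U) hxVU]
    congr 1
    exact TopCat.Presheaf.germ_res_apply X.presheaf _ _ hxVU s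
  choose V hVU hVne s hxV hs using h
  obtain ⟨t, ht, -⟩ := X.sheaf.existsUnique_gluing' V U (fun x => homOfLE (hVU x))
    (fun x hx => TopologicalSpace.Opens.mem_iSup.mpr ⟨⟨x, hx⟩, hxV ⟨x, hx⟩⟩) s fun x y => by
      have hg : genericPoint X ∈ V x ⊓ V y :=
        ⟨((genericPoint_spec X).mem_open_set_iff (V x).isOpen).mpr (by simpa using hVne x),
          ((genericPoint_spec X).mem_open_set_iff (V y).isOpen).mpr (by simpa using hVne y)⟩
      apply germ_injective_of_isIntegral X (genericPoint X) hg
      refine (TopCat.Presheaf.germ_res_apply X.presheaf _ _ hg _).trans (Eq.trans ?_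
        (TopCat.Presheaf.germ_res_apply X.presheaf _ _ hg _).symm)
      exact (hs x).trans (hs y).symm
  refine ⟨t, ?_⟩
  obtain ⟨x⟩ := ‹Nonempty U›
  rw [← hs x, ← ht x]
  exact (TopCat.Presheaf.germ_res_apply X.presheaf _ _ _ _).symm

/-- Pulling back sections and rational functions along a dominant morphism is compatible. -/
theorem functionFieldMap_germToFunctionField {X Y : Scheme.{u}} [IsIntegral X] [IsIntegral Y]
    (φ : X ⟶ Y) (hφ : IsDominant φ) (U : Y.Opens) (V : X.Opens) [Nonempty U] [hV : Nonempty V]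
    (e : V ≤ φ ⁻¹ᵁ U) (s : Γ(Y, U)) :
    functionFieldMap φ hφ (Y.germToFunctionField U s) =
      X.germToFunctionField V (φ.appLE U V e s) := by
  have ⟨x, hx⟩ := hV
  have hφx : φ x ∈ U := e hx
  rw [← Scheme.algebraMap_germ_eq_germToFunctionField (X := Y) (U := U) hφx,
    functionFieldMap_algebraMap, Scheme.Hom.germ_stalkMap_apply φ U x hφx,
    ← Scheme.algebraMap_germ_eq_germToFunctionField (X := X) (U := V) hx]
  congr 1
  exact (TopCat.Presheaf.germ_res_apply X.presheaf (homOfLE e) x hx _).symm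

/-- The domain of definition of a rational function. -/
def domainOfDefinition {X : Scheme.{u}} [IsIntegral X] (f : X.functionField) : X.Opens where
  carrier := {x | f ∈ localRing X x}
  is_open' := isOpen_iff_forall_mem_open.mpr fun x hx => by
    obtain ⟨U, hxU, s, rfl⟩ := mem_localRing_iff.mp hx
    have : Nonempty U := ⟨⟨x, hxU⟩⟩
    refine ⟨U, fun y hy => ⟨X.presheaf.germ U y hy s, ?_⟩, U.isOpen, hxU⟩
    rw [Scheme.algebraMap_germ_eq_germToFunctionField,
      Scheme.algebraMap_germ_eq_germToFunctionField]

/-- An invariant rational function which is regular at `x` comes from a rational function which is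
regular at the image of `x` in the quotient: its domain of definition is a union of orbits, hence
the preimage of an open set of the quotient. -/
theorem IsQuotient.exists_functionFieldMap_eq {G : Type v} [Group G] {X Q : Scheme.{u}}
    [IsIntegral X] [IsIntegral Q] {ρ : G →* Aut X} {π : X ⟶ Q} (h : IsQuotient ρ π)
    (f : X.functionField) (hf : ∀ g, functionFieldMap (ρ g).hom (isDominant_aut _) f = f)
    (x : X) (hx : f ∈ localRing X x) :
    ∃ f' ∈ localRing Q (π x), functionFieldMap π h.isDominant f' = f := by
  have hV : π ⁻¹' (π '' (domainOfDefinition f : Set X)) = domainOfDefinition f := by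
    refine Set.Subset.antisymm ?_ (Set.subset_preimage_image _ _)
    rintro y ⟨z, hz, hzy⟩
    obtain ⟨g, rfl⟩ := h.exists_of_eq y z hzy.symm
    change f ∈ localRing X y
    rw [← hf g]
    exact functionFieldMap_mem_localRing (ρ g).hom (isDominant_aut _) y hz
  let U : Q.Opens := ⟨π '' (domainOfDefinition f : Set X), h.isQuotientMap.isOpen_preimage.mp
    (hV.symm ▸ (domainOfDefinition f).isOpen)⟩
  have hU : ∀ y ∈ π ⁻¹ᵁ U, f ∈ localRing X y := fun y hy => hV.subset hy
  have hxU : π x ∈ U := ⟨x, hx, rfl⟩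
  have : Nonempty U := ⟨⟨_, hxU⟩⟩
  have : Nonempty (π ⁻¹ᵁ U) := ⟨⟨x, hxU⟩⟩
  clear_value U
  clear hV hx
  obtain ⟨s, rfl⟩ := exists_germToFunctionField_eq (π ⁻¹ᵁ U) f hU
  obtain ⟨t, rfl⟩ := h.exists_app_eq U s fun g => by
    apply X.germToFunctionField_injective (π ⁻¹ᵁ U)
    rw [← functionFieldMap_germToFunctionField _ (isDominant_aut _)]
    exact hf g
  refine ⟨Q.germToFunctionField U t, ⟨Q.presheaf.germ U _ hxU t,
    Scheme.algebraMap_germ_eq_germToFunctionField _ _ _⟩, ?_⟩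
  rw [functionFieldMap_germToFunctionField π h.isDominant U (π ⁻¹ᵁ U) le_rfl,
    Scheme.Hom.appLE_eq_app]


/-! ### The section ring of a quotient -/

theorem mem_localRing_genericPoint {X : Scheme.{u}} [IsIntegral X] (f : X.functionField) :
    f ∈ localRing X (genericPoint X) := by
  refine ⟨f, ?_⟩
  rw [RingHom.algebraMap_toAlgebra, TopCat.Presheaf.stalkSpecializes_refl]
  rfl

theorem mul_pow_mem_localRing_of_mk_eq {X : Scheme.{u}} [IsIntegral X] {x : X}
    {e e' : X.functionFieldˣ} (h : (e : X.functionFieldˣ ⧸ localUnits X x) = e')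
    {f : X.functionField} {m : ℕ} (hf : f * (e : X.functionField) ^ m ∈ localRing X x) :
    f * (e' : X.functionField) ^ m ∈ localRing X x := by
  have h1 := mem_localRing_of_mem_localUnits (QuotientGroup.eq.mp h)
  have h2 := mul_mem hf (pow_mem h1 m)
  rwa [mul_assoc, ← mul_pow, Units.val_mul, Units.mul_inv_cancel_left] at h2

theorem IsQuotient.functionFieldMap_invariant {G : Type v} [Group G] {X Q : Scheme.{u}}
    [IsIntegral X] [IsIntegral Q] {ρ : G →* Aut X} {π : X ⟶ Q} (h : IsQuotient ρ π)
    (g : G) (f : Q.functionField) :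
    functionFieldMap (ρ g).hom (isDominant_aut _) (functionFieldMap π h.isDominant f) =
      functionFieldMap π h.isDominant f := by
  have := h.isDominant
  have := isDominant_aut (ρ g)
  rw [← functionFieldMap_comp (ρ g).hom π _ _ inferInstance]
  congr 1
  simp only [h.comp_eq]

/-- A rational function on the quotient is a section of `𝒪(mD)` if and only if its pull-back is a
section of `𝒪(m π^*D)`. -/
theorem IsQuotient.functionFieldMap_mem_sections_iff {G : Type v} [Group G] {X Q : Scheme.{u}}
    [IsIntegral X] [IsIntegral Q] {ρ : G →* Aut X} {π : X ⟶ Q} (h : IsQuotient ρ π)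
    (D : QCartierDivisor Q) (hD : IsNormal X ∨ D.index = 1) {m : ℕ} {f : Q.functionField} :
    functionFieldMap π h.isDominant f ∈ (D.pullback π h.isDominant hD).sections m ↔
      f ∈ D.sections m := by
  constructor
  · intro hf q e he
    obtain ⟨x, rfl⟩ := h.isQuotientMap.surjective q
    have h1 := hf x (Units.map (functionFieldMap π h.isDominant).toMonoidHom e) (by
      change _ = QuotientGroup.map _ _ _ _ (D.numerator.germ (π x))
      rw [← he]
      rfl)
    have h2 : functionFieldMap π h.isDominant (f ^ D.index * (e : Q.functionField) ^ m) ∈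
        localRing X x := by
      rw [map_mul, map_pow, map_pow]
      exact h1
    obtain ⟨f', hf', hff'⟩ := h.exists_functionFieldMap_eq _
      (fun g => h.functionFieldMap_invariant g _) x h2
    rwa [(functionFieldMap π h.isDominant).injective hff'] at hf'
  · intro hf x e he
    obtain ⟨e', he'⟩ := QuotientGroup.mk_surjective (D.numerator.germ (π x))
    have h1 := functionFieldMap_mem_localRing π h.isDominant x (hf (π x) e' he')
    rw [map_mul, map_pow, map_pow] at h1
    refine mul_pow_mem_localRing_of_mk_eq
      (e := Units.map (functionFieldMap π h.isDominant).toMonoidHom e') ?_ h1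
    rw [he]
    change _ = QuotientGroup.map _ _ _ _ (D.numerator.germ (π x))
    rw [← he']
    rfl

/-- The pull-back of sections `R(Q, D) → R(X, π^*D)` along a quotient `π : X ⟶ Q`. -/
def IsQuotient.sectionRingPullback {G : Type v} [Group G] {X Q : Scheme.{u}}
    [IsIntegral X] [IsIntegral Q] {ρ : G →* Aut X} {π : X ⟶ Q} (h : IsQuotient ρ π)
    (D : QCartierDivisor Q) (hD : IsNormal X ∨ D.index = 1) :
    D.grading →+*ᵍ (D.pullback π h.isDominant hD).grading where
  toRingHom := ((Polynomial.mapRingHom (functionFieldMap π h.isDominant)).comp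
    D.sectionRing.subtype).codRestrict (D.pullback π h.isDominant hD).sectionRing fun p m => by
      change (Polynomial.map _ (p : Polynomial Q.functionField)).coeff m ∈ _
      rw [Polynomial.coeff_map]
      exact (h.functionFieldMap_mem_sections_iff D hD).mpr (p.2 m)
  map_mem {m p} hp i hi := by
    change (Polynomial.map _ (p : Polynomial Q.functionField)).coeff i = 0
    rw [Polynomial.coeff_map, hp i hi, map_zero]

theorem IsQuotient.coeff_sectionRingPullback {G : Type v} [Group G] {X Q : Scheme.{u}}
    [IsIntegral X] [IsIntegral Q] {ρ : G →* Aut X} {π : X ⟶ Q} (h : IsQuotient ρ π)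
    (D : QCartierDivisor Q) (hD : IsNormal X ∨ D.index = 1) (p : D.sectionRing) (m : ℕ) :
    (h.sectionRingPullback D hD p : Polynomial X.functionField).coeff m =
      functionFieldMap π h.isDominant ((p : Polynomial Q.functionField).coeff m) :=
  Polynomial.coeff_map _ _

theorem QCartierDivisor.coeff_sectionRingMap {X : Scheme.{u}} [IsIntegral X]
    (D : QCartierDivisor X) (a : Aut X)
    (ha : D.numerator.pullback a.hom (isDominant_aut a) = D.numerator) (p : D.sectionRing)
    (m : ℕ) : (D.sectionRingMap a ha p : Polynomial X.functionField).coeff m =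
      functionFieldMap a.hom (isDominant_aut a) ((p : Polynomial X.functionField).coeff m) :=
  Polynomial.coeff_map _ _

/-- The section ring of the quotient is the ring of invariants of the section ring of `X`. -/
theorem IsQuotient.isInvariants_sectionRingPullback {G : Type v} [Group G] {X Q : Scheme.{u}}
    [IsIntegral X] [IsIntegral Q] {ρ : G →* Aut X} {π : X ⟶ Q} (h : IsQuotient ρ π)
    (D : QCartierDivisor Q) (hD : IsNormal X ∨ D.index = 1) :
    IsInvariants (h.sectionRingPullback D hD).toRingHom fun g =>
      ((D.pullback π h.isDominant hD).sectionRingMap (ρ g)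
        (h.pullback_invariant D hD g)).toRingHom where
  injective p q hpq := by
    refine Subtype.ext (Polynomial.ext fun m => (functionFieldMap π h.isDominant).injective ?_)
    rw [← h.coeff_sectionRingPullback D hD, ← h.coeff_sectionRingPullback D hD]
    exact congr(($hpq : Polynomial X.functionField).coeff m)
  one_apply p := by
    have : ∀ (D' : QCartierDivisor X) (a : Aut X)
        (ha : D'.numerator.pullback a.hom (isDominant_aut a) = D'.numerator) (p : D'.sectionRing),
        a = 1 → D'.sectionRingMap a ha p = p := by
      rintro D' a ha p rfl
      rw [D'.sectionRingMap_one]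
      rfl
    exact this _ _ _ p (map_one ρ)
  mul_apply g g' p := by
    have : ∀ (D' : QCartierDivisor X)
        (hD' : ∀ g, D'.numerator.pullback (ρ g).hom (isDominant_aut _) = D'.numerator) (a : Aut X)
        (ha : D'.numerator.pullback a.hom (isDominant_aut a) = D'.numerator) (p : D'.sectionRing),
        a = ρ g * ρ g' → D'.sectionRingMap a ha p =
          D'.sectionRingMap (ρ g') (hD' g') (D'.sectionRingMap (ρ g) (hD' g) p) := by
      rintro D' hD' a ha p rfl
      rw [D'.sectionRingMap_mul (ρ g) (ρ g') (hD' g) (hD' g') ha]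
      rfl
    exact this _ (h.pullback_invariant D hD) _ _ p (map_mul ρ g g')
  apply_map g p := by
    refine Subtype.ext (Polynomial.ext fun m => ?_)
    refine (QCartierDivisor.coeff_sectionRingMap _ _ _ _ _).trans ?_
    refine (congrArg _ (h.coeff_sectionRingPullback D hD p m)).trans ?_
    refine Eq.trans ?_ (h.coeff_sectionRingPullback D hD p m).symm
    exact h.functionFieldMap_invariant g _
  exists_of_forall p hp := by
    obtain ⟨p', hp'⟩ : ∃ p', Polynomial.map (functionFieldMap π h.isDominant) p' =
        (p : Polynomial X.functionField) := by
      rw [← Polynomial.mem_lifts, Polynomial.lifts_iff_coeff_lifts]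
      intro m
      obtain ⟨f', -, hf'⟩ := h.exists_functionFieldMap_eq
        ((p : Polynomial X.functionField).coeff m) (fun g => by
          refine (QCartierDivisor.coeff_sectionRingMap _ _
            (h.pullback_invariant D hD g) _ _).symm.trans ?_
          exact congr(($(hp g) : Polynomial X.functionField).coeff m))
        (genericPoint X) (mem_localRing_genericPoint _)
      exact ⟨f', hf'⟩
    refine ⟨⟨p', fun m => ?_⟩, Subtype.ext hp'⟩
    rw [← h.functionFieldMap_mem_sections_iff D hD, ← Polynomial.coeff_map, hp']
    exact p.2 m

theorem functionFieldMap_constants {k : Type u} [Field k] {X Y : Scheme.{u}} [IsIntegral X]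
    [IsIntegral Y] (φ : X ⟶ Y) (hφ : IsDominant φ) (t : Y ⟶ Spec (.of k)) (c : k) :
    functionFieldMap φ hφ (constants t c) = constants (φ ≫ t) c := by
  have ⟨x⟩ : Nonempty X := inferInstance
  have : Nonempty (⊤ : Y.Opens) := ⟨⟨φ x, trivial⟩⟩
  have : Nonempty (φ ⁻¹ᵁ ⊤ : X.Opens) := ⟨⟨x, trivial⟩⟩
  refine (functionFieldMap_germToFunctionField φ hφ ⊤ (φ ⁻¹ᵁ ⊤) le_rfl _).trans ?_
  rw [Scheme.Hom.appLE_eq_app]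
  simp only [constants, Scheme.Hom.comp_appTop]
  rfl

theorem IsQuotient.sectionRingPullback_baseHom {k : Type u} [Field k] {G : Type v} [Group G]
    {X Q : Scheme.{u}} [IsIntegral X] [IsIntegral Q] {ρ : G →* Aut X} {π : X ⟶ Q}
    (h : IsQuotient ρ π) (D : QCartierDivisor Q) (hD : IsNormal X ∨ D.index = 1)
    (t : Q ⟶ Spec (.of k)) (c : k) :
    h.sectionRingPullback D hD (D.baseHom t c) =
      (D.pullback π h.isDominant hD).baseHom (π ≫ t) c := by
  refine Subtype.ext ?_
  change Polynomial.map (functionFieldMap π h.isDominant) (Polynomial.C (constants t c)) =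
    Polynomial.C (constants (π ≫ t) c)
  rw [Polynomial.map_C, functionFieldMap_constants]

end FiniteQuotient

end

theorem lemma6p1 {k : Type u} [Field k] [IsAlgClosed k] [CharZero k]
    {G : Type v} [Group G] [Finite G]
    {X Q : Scheme.{u}} [IsIntegral X] [IsIntegral Q]
    (s : X ⟶ Spec (.of k)) (t : Q ⟶ Spec (.of k))
    (hX : FiniteQuotient.IsProjectiveOver s)
    (ρ : G →* Aut X) (hρ : ∀ g : G, (ρ g).hom ≫ s = s)
    (π : X ⟶ Q) (hπ : FiniteQuotient.IsQuotient ρ π) (hπt : π ≫ t = s)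
    (D : FiniteQuotient.QCartierDivisor Q)
    (hD : FiniteQuotient.IsNormal X ∨ D.index = 1)
    (hfin : ((D.pullback π hπ.isDominant hD).baseHom s).FiniteType) :
    (D.baseHom t).FiniteType ∧
      ∃ q : (D.pullback π hπ.isDominant hD).proj ⟶ D.proj,
        q ≫ D.projToBase t = (D.pullback π hπ.isDominant hD).projToBase s ∧
        FiniteQuotient.IsQuotient
          ((D.pullback π hπ.isDominant hD).projAction ρ (hπ.pullback_invariant D hD)) q := by
  subst hπt
  have hinv := hπ.isInvariants_sectionRingPullback D hD
  refine ⟨hinv.finiteType (D.baseHom t) ?_,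
    FiniteQuotient.projMap (hπ.sectionRingPullback D hD) hinv.isRelevant, ?_, ?_⟩
  · convert hfin
    exact RingHom.ext (hπ.sectionRingPullback_baseHom D hD t)
  · exact FiniteQuotient.projMap_toSpecZero _ _ _ _ (hπ.sectionRingPullback_baseHom D hD t)
  · exact hinv.isQuotient_projMap _ (fun g => FiniteQuotient.isRelevant_of_irrelevant_le
      ((D.pullback π hπ.isDominant hD).irrelevant_le ρ (hπ.pullback_invariant D hD) g)) _
      fun g => (FiniteQuotient.projMap_eq_map _ _).symm
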